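/- Let $0<\alpha<1$, $0<H<1$, $\sigma>0$. Let $D=\{D(s)\}_{s\ge 0}$ be a standard $\alpha$-stable subordinator (a subordinator with $\mathbb E[e^{-\lambda D(s)}]=e^{-s\lambda^{\alpha}}$ for $\lambda>0$), and let $Y(t)=\inf\{s\ge 0: D(s)>t\}$, $t\ge 0$, be the inverse $\alpha$-stable subordinator. Let $B_H$ be a fractional Brownian motion independent of $Y$: a centred Gaussian process with a.s. continuous paths and $\mathbb E[B_H(t)B_H(s)]=\frac{\sigma^2}{2}(s^{2H}+t^{2H}-|t-s|^{2H})$. Put $Z(t)=B_H(Y(t))$ and $U^{\gamma}(t)=\mathbb E[Y(t)^{\gamma}]$. Let $B(a,b;z)=\int_0^z u^{a-1}(1-u)^{b-1}\,du$ be the incomplete Beta function, $B(a,b)=\Gamma(a)\Gamma(b)/\Gamma(a+b)$, and write $b=\alpha(2H-1)+1$; $f\sim g$ means that $f/g\to1$. Then $Y(t)$ and $Z(t)$ have finite moments of all orders, and the following hold. 1. For $t\ge0$, $\lambda\ge 0$: $\mathbb E[e^{-\lambda Y(t)}]=\sum_{k\ge0}\frac{(-\lambda t^{\alpha})^k}{\Gamma(\alpha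 k+1)}$. 2. For $t\ge 0$: $U^{2H}(t)=\frac{\Gamma(2H+1)t^{2\alpha H}}{\Gamma(2\alpha H+1)}$, $\ \mathbb E[Z(t)]=0$ and $\operatorname{Var}(Z(t))=\frac{\sigma^2\Gamma(2H+1)t^{2\alpha H}}{\Gamma(2\alpha H+1)}$. 3. For $0<s\le t$, with $G(s,t)=\frac{\Gamma(2H+1)t^{2\alpha H}}{\Gamma(\alpha)\Gamma(b)}B(\alpha,b;s/t)$, $$\operatorname{Cov}(Z(t),Z(s))=\frac{\sigma^2}{2}\left\{\frac{\Gamma(2H+1)s^{2\alpha H}}{\Gamma(2\alpha H+1)}+G(s,t)\right\},$$ $$\operatorname{corr}(Z(t),Z(s))=\frac12\left\{\left(\frac st\right)^{\alpha H}+\frac{\Gamma(2\alpha H+1)}{\Gamma(2H+1)}\frac{G(s,t)}{(ts)^{\alpha H}}\right\}.$$ If $H=1/2$, these are $\frac{\sigma^2 s^{\alpha}}{\Gamma(\alpha+1)}$ and $(s/t)^{\alpha/2}$. 4. For fixed $s>0$, as $t\to\infty$, the difference between $\operatorname{Cov}(Z(t),Z(s))$ and $$\frac{\sigma^2}{2}\left\{\frac{\Gamma(2H+1)s^{2\alpha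 H}}{\Gamma(2\alpha H+1)}+\frac{\Gamma(2H+1)t^{2\alpha H}}{\Gamma(\alpha+1)\Gamma(b)}\left(\frac st\right)^{\alpha}\right\}$$ tends to $0$, their ratio tends to $1$, and $$\operatorname{corr}(Z(t),Z(s))\sim\frac12\left\{\left(\frac st\right)^{\alpha H}+\frac{1}{\alpha B(\alpha,b)}\left(\frac st\right)^{\alpha(1-H)}\right\};$$ in particular $\sum_{n\in\mathbb N}\operatorname{corr}(Z(n),Z(s))$ is not summable. 5. For $0<s\le t$, $\kappa>0$ and $m>0$, $$\mathbb E|Y(t)-Y(s)|^{\kappa}=\frac{\Gamma(\kappa+1)t^{\alpha\kappa}}{\Gamma(\alpha\kappa+1)}-\frac{\Gamma(\kappa+1)t^{\alpha\kappa}}{\Gamma(\alpha)\Gamma(\alpha(\kappa-1)+1)}B(\alpha,\alpha(\kappa-1)+1;s/t),$$ $$\mathbb E|Z(t)-Z(s)|^{m}=\frac{(2\sigma^2)^{m/2}\Gamma(\frac{m+1}2)\Gamma(mH+1)t^{\alpha mH}}{\sqrt\pi}\left[\frac1{\Gamma(\alpha mH+1)}-\frac{B(\alpha,\alpha(mH-1)+1;s/t)}{\Gamma(\alpha)\Gamma(\alpha(mH-1)+1)}\right].$$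 6. For $0<s\le t$, $$\mathbb E[Y(t)Y(s)]=\frac{s^{2\alpha}}{\Gamma(2\alpha+1)}+\frac1{\Gamma(\alpha)\Gamma(\alpha+1)}\int_0^s(t-y)^{\alpha}y^{\alpha-1}\,dy,$$ $$\operatorname{Cov}(Y(t),Y(s))=\frac{s^{2\alpha}}{\Gamma(2\alpha+1)}+\frac{t^{2\alpha}}{\Gamma(\alpha)\Gamma(\alpha+1)}B(\alpha,\alpha+1;s/t)-\frac{(ts)^{\alpha}}{\Gamma(\alpha+1)^2},$$ and for $0<s<t$, $\ \partial_t\partial_s\mathbb E[Y(t)Y(s)]=\dfrac{1}{\Gamma(\alpha)^2[s(t-s)]^{1-\alpha}}$. 7. For $0<t\le v$, $$\operatorname{Cov}(Z(t)-Z(0),Z(t+v)-Z(v))=\frac{\sigma^2H\Gamma(2H)}{\Gamma(\alpha)\Gamma(b)}\int_0^t\left[(t+v-y)^{\alpha(2H-1)}-(v-y)^{\alpha(2H-1)}\right]y^{\alpha-1}\,dy.$$ For fixed $t>0$ and $H\ne1/2$, as $v\to\infty$ this is $$\sim\frac{\frac{\sigma^2}{2}\Gamma(2H+1)\,t^{\alpha+1}}{\Gamma(\alpha+1)\Gamma(\alpha(2H-1))}\,v^{\alpha(2H-1)-1},$$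 while for $H=1/2$ it is $0$ for all $v\ge t$. If $1/2<H<1$, then $\sum_{n\in\mathbb N}\operatorname{Cov}(Z(t)-Z(0),Z(t+n)-Z(n))$ is not summable. -/

import Mathlib

open MeasureTheory ProbabilityTheory Filter Asymptotics
open scoped NNReal ENNReal Topology

/-- A subordinator: a real-valued Lévy process started at `0` whose paths are almost surely
non-decreasing and right-continuous (left limits exist automatically by monotonicity). -/
structure IsSubordinator {Ω : Type*} [MeasurableSpace Ω] (D : ℝ≥0 → Ω → ℝ) (P : Measure Ω) :
    Prop where
  measurable : ∀ s, Measurable (D s)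
  zero : ∀ᵐ ω ∂P, D 0 ω = 0
  indep_increments : HasIndepIncrements D P
  stationary_increments : ∀ s h, IdentDistrib (D (s + h) - D s) (D h - D 0) P P
  mono : ∀ᵐ ω ∂P, Monotone fun s ↦ D s ω
  right_continuous : ∀ᵐ ω ∂P, ∀ s, ContinuousWithinAt (fun r ↦ D r ω) (Set.Ici s) s

/-- A standard `α`-stable subordinator: a subordinator with Laplace exponent `x ↦ x ^ α`. -/
structure IsStableSubordinator {Ω : Type*} [MeasurableSpace Ω] (α : ℝ) (D : ℝ≥0 → Ω → ℝ)
    (P : Measure Ω) : Prop extends IsSubordinator D P where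
  laplace : ∀ (s : ℝ≥0) (x : ℝ), 0 < x →
    ∫ ω, Real.exp (-(x * D s ω)) ∂P = Real.exp (-(s * x ^ α))

/-- The inverse (first-passage time) `Y t = inf {s ≥ 0 : D s > t}` of a process `D`. -/
noncomputable def inverseProcess {Ω : Type*} (D : ℝ≥0 → Ω → ℝ) (t : ℝ≥0) (ω : Ω) : ℝ≥0 :=
  sInf {s : ℝ≥0 | (t : ℝ) < D s ω}

/-- Fractional Brownian motion on `[0, ∞)` with Hurst parameter `H` and
`Var (B 1) = σ ^ 2`: a centred Gaussian process with almost surely continuous paths and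
covariance function `(σ ^ 2 / 2) * (s ^ (2 H) + t ^ (2 H) - |t - s| ^ (2 H))`. -/
structure IsFractionalBrownianMotion {Ω : Type*} [MeasurableSpace Ω] (H σ : ℝ)
    (B : ℝ≥0 → Ω → ℝ) (P : Measure Ω) : Prop where
  measurable : ∀ t, Measurable (B t)
  gaussian : IsGaussianProcess B P
  mean_zero : ∀ t, ∫ ω, B t ω ∂P = 0
  covariance : ∀ s t : ℝ≥0, ∫ ω, B t ω * B s ω ∂P =
    σ ^ 2 / 2 * ((s : ℝ) ^ (2 * H) + (t : ℝ) ^ (2 * H) - |(t : ℝ) - s| ^ (2 * H))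
  continuous : ∀ᵐ ω ∂P, Continuous fun t ↦ B t ω

/-- The moment function `U^γ(t) = E[Y(t)^γ]`. -/
noncomputable def momentFunction {Ω : Type*} [MeasurableSpace Ω] (Y : ℝ≥0 → Ω → ℝ≥0)
    (P : Measure Ω) (γ : ℝ) (t : ℝ≥0) : ℝ :=
  ∫ ω, (Y t ω : ℝ) ^ γ ∂P

/-- The incomplete Beta function `B(a, b; z)`, for `a, b > 0` and `0 ≤ z ≤ 1`. -/
noncomputable def incompleteBeta (a b z : ℝ) : ℝ :=
  ∫ u in (0 : ℝ)..z, u ^ (a - 1) * (1 - u) ^ (b - 1)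

/-- The correlation coefficient of two real random variables. -/
noncomputable def correlation {Ω : Type*} [MeasurableSpace Ω] (X Y : Ω → ℝ) (P : Measure Ω) : ℝ :=
  covariance X Y P / (√(variance X P) * √(variance Y P))

/-! Everything reduces to the absolute moments of the increments of `Y`, and these come from an
overshoot identity combined with the potential measure of `D`.

By uniqueness of Laplace transforms, `D s` has the law of `s ^ (1/α) * D 1`. Integrating the
derivative of the Laplace transform against a power gives `E[D(1)^r] = Γ(1 - r/α) / Γ(1 - r)` for
all `r < α`. On the event `s < D u ≤ t`, the inequality `Y t - u ≥ r` amounts, up to boundary cases,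
to `D (u + r) - D u ≤ t - D u`. Since the increment is independent of `D u` and self-similar, `Y t -
u` is there distributed as `((t - D u) / D' 1) ^ α` with `D' 1` an independent copy of `D 1`. Hence
the moment of order `γ > -1` of the overshoot is a constant times that of `(t - D u) ^ (αγ)`
(`setLIntegral_rpow_sub`).

Now `(Y t - Y s)^κ` is the integral of `κ (Y t - u)^(κ-1)` over `Y s < u < Y t`, and for almost
every `u` this event is `s < D u ≤ t` up to a null set. Tonelli, the overshoot moments with `γ = κ -
1`, and the potential density `y^(α-1) / Γ(α)` (`lintegral_potential`) leave a Beta integral over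
`(s, t]`: the complete Beta function minus the incomplete one. This works for every `κ > 0`,
including `κ < 1`.

Given the independent time change, an increment of `Z` is centred Gaussian with variance `σ² |Y t -
Y s|^(2H)`, so its `m`-th absolute moment is a Gaussian constant times the moment of order `mH` of
the increment of `Y`. Covariances of `Z` and `Y` follow by polarisation. The asymptotics come from
the first-order expansion of the incomplete Beta function at `0` and from the mean value theorem. -/

/-! ### Laplace transforms determine laws on the half-line -/

/-- For `X ≥ 0` the integrand has modulus at most `1` on the closed left half-plane. This carries an
identity from the open half-plane, where the transform is analytic, to the imaginary axis, where it
is the characteristic function. -/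
theorem continuous_complexMGF_axis {Ω : Type*} [MeasurableSpace Ω] {P : Measure Ω}
    [IsProbabilityMeasure P] {X : Ω → ℝ} (hX : AEMeasurable X P) (h0 : ∀ᵐ ω ∂P, 0 ≤ X ω) (ξ : ℝ) :
    Tendsto (fun ε : ℝ ↦ complexMGF X P (-ε + ξ * Complex.I)) (𝓝[>] 0)
      (𝓝 (complexMGF X P (ξ * Complex.I))) := by
  refine tendsto_integral_filter_of_dominated_convergence (fun _ ↦ 1) ?_ ?_
    (integrable_const _) ?_
  · exact Eventually.of_forall fun ε ↦ by fun_prop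
  · filter_upwards [self_mem_nhdsWithin] with ε hε
    filter_upwards [h0] with ω hω
    rw [Complex.norm_exp]
    have hε' : (0 : ℝ) < ε := hε
    have : ((-(ε : ℂ) + ξ * Complex.I) * X ω).re = -(ε * X ω) := by simp
    rw [this, Real.exp_le_one_iff]
    have := mul_nonneg hε'.le hω
    linarith
  · refine Eventually.of_forall fun ω ↦ ?_
    have hc : Continuous fun ε : ℝ ↦ Complex.exp ((-(ε : ℂ) + ξ * Complex.I) * X ω) := by fun_prop
    have := (hc.tendsto 0).mono_left (nhdsWithin_le_nhds (s := Set.Ioi 0))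
    simpa using this

theorem Iio_subset_interior_integrableExpSet {Ω : Type*} [MeasurableSpace Ω] {P : Measure Ω}
    [IsProbabilityMeasure P] {X : Ω → ℝ} (hX : AEMeasurable X P) (h0 : ∀ᵐ ω ∂P, 0 ≤ X ω) :
    Set.Iio 0 ⊆ interior (integrableExpSet X P) := by
  refine interior_maximal (fun t ht ↦ ?_) isOpen_Iio
  refine (integrable_const (1 : ℝ)).mono' (by fun_prop) ?_
  filter_upwards [h0] with ω hω
  rw [Real.norm_eq_abs, Real.abs_exp, Real.exp_le_one_iff]
  exact mul_nonpos_of_nonpos_of_nonneg (le_of_lt ht) hω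

/-- Nonnegative random variables with the same Laplace transform have the same law. -/
theorem map_eq_of_laplace_eq {Ω Ω' : Type*} [MeasurableSpace Ω] [MeasurableSpace Ω']
    {P : Measure Ω} {Q : Measure Ω'} [IsProbabilityMeasure P] [IsProbabilityMeasure Q]
    {X : Ω → ℝ} {Y : Ω' → ℝ} (hX : AEMeasurable X P) (hY : AEMeasurable Y Q)
    (hX0 : ∀ᵐ ω ∂P, 0 ≤ X ω) (hY0 : ∀ᵐ ω ∂Q, 0 ≤ Y ω)
    (h : ∀ x : ℝ, 0 < x → ∫ ω, Real.exp (-(x * X ω)) ∂P = ∫ ω, Real.exp (-(x * Y ω)) ∂Q) :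
    P.map X = Q.map Y := by
  have hXan : AnalyticOnNhd ℂ (complexMGF X P) {z | z.re < 0} := fun z hz ↦
    analyticAt_complexMGF (Iio_subset_interior_integrableExpSet hX hX0 hz)
  have hYan : AnalyticOnNhd ℂ (complexMGF Y Q) {z | z.re < 0} := fun z hz ↦
    analyticAt_complexMGF (Iio_subset_interior_integrableExpSet hY hY0 hz)
  have hreal : ∀ x : ℝ, x < 0 → complexMGF X P x = complexMGF Y Q x := by
    intro x hx
    rw [complexMGF_ofReal, complexMGF_ofReal]
    have := h (-x) (by linarith)
    simp only [neg_mul, neg_neg] at this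
    rw [mgf, mgf, this]
  have heq : Set.EqOn (complexMGF X P) (complexMGF Y Q) {z | z.re < 0} := by
    refine hXan.eqOn_of_preconnected_of_frequently_eq hYan
      (convex_halfSpace_re_lt 0).isPreconnected (z₀ := ((-1 : ℝ) : ℂ)) (by simp) ?_
    -- Equality on the negative real axis suffices for the identity theorem: these points accumulate
    -- at `-1` without meeting it.
    have hf : Tendsto (fun n : ℕ ↦ (((-1 : ℝ) - 1 / ((n : ℝ) + 1) : ℝ) : ℂ)) atTop
        (𝓝[≠] ((-1 : ℝ) : ℂ)) := by
      refine tendsto_nhdsWithin_iff.2 ⟨?_, Eventually.of_forall fun n ↦ ?_⟩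
      · refine (Complex.continuous_ofReal.tendsto _).comp ?_
        simpa using tendsto_const_nhds.sub (tendsto_one_div_add_atTop_nhds_zero_nat (𝕜 := ℝ))
      · have : (0 : ℝ) < 1 / ((n : ℝ) + 1) := by positivity
        simp only [Set.mem_compl_iff, Set.mem_singleton_iff, Complex.ofReal_inj]
        linarith
    refine hf.frequently (Frequently.of_forall fun n ↦ hreal _ ?_)
    have : (0 : ℝ) < 1 / ((n : ℝ) + 1) := by positivity
    linarith
  have := Measure.isProbabilityMeasure_map hX
  have := Measure.isProbabilityMeasure_map hY
  refine Measure.ext_of_charFun ?_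
  ext ξ
  rw [← complexMGF_mul_I hX, ← complexMGF_mul_I hY]
  refine tendsto_nhds_unique (continuous_complexMGF_axis hX hX0 ξ) ?_
  refine (continuous_complexMGF_axis hY hY0 ξ).congr' ?_
  filter_upwards [self_mem_nhdsWithin] with ε hε
  exact (heq (by simpa using hε)).symm

theorem IsSubordinator.ae_nonneg {Ω : Type*} [MeasurableSpace Ω] {P : Measure Ω}
    {D : ℝ≥0 → Ω → ℝ} (hD : IsSubordinator D P) : ∀ᵐ ω ∂P, ∀ s, 0 ≤ D s ω := by
  filter_upwards [hD.zero, hD.mono] with ω h0 hm s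
  rw [← h0]
  exact hm zero_le

/-! ### Self-similarity and real moments of the stable subordinator -/

section Subordinator

variable {Ω : Type*} [MeasurableSpace Ω] {P : Measure Ω} [IsProbabilityMeasure P] {α : ℝ}
  {D : ℝ≥0 → Ω → ℝ}

/-- Both variables have Laplace transform `exp (-(s * x ^ α))`. The time `s = 0` is separate because
the rescaled argument `x * s ^ (1/α)` must be positive. -/
theorem IsStableSubordinator.map_eq (hα : α ∈ Set.Ioo (0 : ℝ) 1) (hD : IsStableSubordinator α D P)
    (s : ℝ≥0) : P.map (D s) = P.map fun ω ↦ (s : ℝ) ^ (1 / α) * D 1 ω := by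
  have hm := hD.measurable
  refine map_eq_of_laplace_eq (hm s).aemeasurable
    ((hm 1).const_mul _).aemeasurable ?_ ?_ fun x hx ↦ ?_
  · filter_upwards [hD.ae_nonneg] with ω h using h s
  · filter_upwards [hD.ae_nonneg] with ω h using by have := h 1; positivity
  · rw [hD.laplace s x hx]
    rcases eq_or_ne s 0 with rfl | hs
    · rw [NNReal.coe_zero, Real.zero_rpow (one_div_ne_zero hα.1.ne')]
      simp
    · have hs' : (0 : ℝ) < s := by positivity
      have := hD.laplace 1 (x * (s : ℝ) ^ (1 / α)) (by positivity)
      simp_rw [← mul_assoc, this]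
      rw [Real.mul_rpow hx.le (by positivity), ← Real.rpow_mul hs'.le,
        one_div_mul_cancel hα.1.ne', Real.rpow_one]
      simp [mul_comm]

/-- On `D 1 ≤ 0` one has `exp (-(x * D 1)) ≥ 1`, so this event has probability at most `exp (-x ^
α)`, which tends to `0` as `x → ∞`. -/
theorem IsStableSubordinator.ae_pos (hα : α ∈ Set.Ioo (0 : ℝ) 1) (hD : IsStableSubordinator α D P) :
    ∀ᵐ ω ∂P, 0 < D 1 ω := by
  have hm := hD.measurable 1
  have hset : MeasurableSet {ω | D 1 ω ≤ 0} := measurableSet_le hm measurable_const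
  have hle : ∀ x : ℝ, 0 < x → P.real {ω | D 1 ω ≤ 0} ≤ Real.exp (-x ^ α) := by
    intro x hx
    have h1 := hD.laplace 1 x hx
    simp only [NNReal.coe_one, one_mul] at h1
    rw [← h1, ← integral_indicator_one hset]
    -- A non-integrable function has Bochner integral `0`, so a positive integral already proves
    -- integrability. The same device recurs below.
    have hint : Integrable (fun ω ↦ Real.exp (-(x * D 1 ω))) P := by
      by_contra hc
      rw [integral_undef hc] at h1
      exact (Real.exp_pos _).ne h1
    refine integral_mono ((integrable_const (1 : ℝ)).indicator hset) hint fun ω ↦ ?_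
    by_cases hω : D 1 ω ≤ 0
    · simp only [Set.indicator, Set.mem_ofPred_eq, hω, if_true, Pi.one_apply, Real.one_le_exp_iff]
      nlinarith
    · simp only [Set.indicator, Set.mem_ofPred_eq, hω, if_false]
      positivity
  have hlim : Tendsto (fun x : ℝ ↦ Real.exp (-x ^ α)) atTop (𝓝 0) :=
    Real.tendsto_exp_neg_atTop_nhds_zero.comp (tendsto_rpow_atTop hα.1)
  have h0 : P.real {ω | D 1 ω ≤ 0} ≤ 0 := ge_of_tendsto hlim
    ((eventually_gt_atTop 0).mono hle)
  have h0' := le_antisymm h0 measureReal_nonneg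
  rw [measureReal_eq_zero_iff] at h0'
  rw [ae_iff]
  simpa using h0'

/-- Differentiation of the Laplace transform, legitimate since `-x` is interior to the domain where
the exponential moment is finite. -/
theorem IsStableSubordinator.integral_mul_exp
    (hD : IsStableSubordinator α D P) {x : ℝ} (hx : 0 < x) :
    Integrable (fun ω ↦ D 1 ω * Real.exp (-(x * D 1 ω))) P ∧
    ∫ ω, D 1 ω * Real.exp (-(x * D 1 ω)) ∂P = α * x ^ (α - 1) * Real.exp (-x ^ α) := by
  have hX : AEMeasurable (D 1) P := (hD.measurable 1).aemeasurable
  have h0 : ∀ᵐ ω ∂P, 0 ≤ D 1 ω := hD.ae_nonneg.mono fun ω h ↦ h 1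
  have hmem : -x ∈ interior (integrableExpSet (D 1) P) :=
    Iio_subset_interior_integrableExpSet hX h0 (by simpa using hx)
  have hder := hasDerivAt_mgf hmem
  have hder2 : HasDerivAt (mgf (D 1) P) (α * x ^ (α - 1) * Real.exp (-x ^ α)) (-x) := by
    have h1 : HasDerivAt (fun t : ℝ ↦ Real.exp (-(-t) ^ α)) (α * x ^ (α - 1) * Real.exp (-x ^ α))
        (-x) := by
      have h2 : HasDerivAt (fun t : ℝ ↦ (-t) ^ α) (-1 * α * (- -x) ^ (α - 1)) (-x) :=
        (hasDerivAt_neg _).rpow_const (Or.inl (by simpa using hx.ne'))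
      convert! h2.neg.exp using 1
      simp only [Pi.neg_apply, neg_neg]
      ring
    refine h1.congr_of_eventuallyEq ?_
    filter_upwards [gt_mem_nhds (show -x < 0 by linarith)] with t ht
    have := hD.laplace 1 (-t) (by linarith)
    simpa [mgf] using this
  refine ⟨?_, ?_⟩
  · have := integrable_pow_mul_exp_of_mem_interior_integrableExpSet hmem 1
    simpa using this
  · have := hder.unique hder2
    simpa using this

/-- The real moments of order `r < α` of a standard `α`-stable variable. -/
theorem IsStableSubordinator.lintegral_rpow (hα : α ∈ Set.Ioo (0 : ℝ) 1)
    (hD : IsStableSubordinator α D P) {r : ℝ} (hr : r < α) :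
    ∫⁻ ω, ENNReal.ofReal (D 1 ω ^ r) ∂P =
      ENNReal.ofReal (Real.Gamma (1 - r / α) / Real.Gamma (1 - r)) := by
  have hα0 := hα.1
  have hG : 0 < Real.Gamma (1 - r) := Real.Gamma_pos_of_pos (by linarith [hα.2])
  have hm := hD.measurable 1
  -- A Gamma integral representing `y ^ r`. Keeping one factor `y` next to the exponential makes it
  -- converge for all `r < 1`, so that positive and negative orders are treated together.
  have key : ∀ y : ℝ, 0 < y → ENNReal.ofReal (y ^ r) = (ENNReal.ofReal (Real.Gamma (1 - r)))⁻¹ *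
      ∫⁻ x in Set.Ioi (0 : ℝ), ENNReal.ofReal (x ^ (-r) * (y * Real.exp (-(x * y)))) := by
    intro y hy
    have h1 := Real.integral_rpow_mul_exp_neg_mul_Ioi (a := 1 - r) (r := y)
      (by linarith [hα.2]) hy
    have h2 : ∫ x in Set.Ioi (0 : ℝ), x ^ (-r) * (y * Real.exp (-(x * y))) =
        y ^ r * Real.Gamma (1 - r) := by
      have : ∀ x : ℝ, x ^ (-r) * (y * Real.exp (-(x * y))) =
          y * (x ^ (1 - r - 1) * Real.exp (-(y * x))) := fun x ↦ by
        rw [show 1 - r - 1 = -r by ring, mul_comm x y]; ring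
      simp_rw [this]
      rw [integral_const_mul, h1, one_div, Real.inv_rpow hy.le, ← Real.rpow_neg hy.le, ← mul_assoc]
      congr 1
      nth_rewrite 1 [← Real.rpow_one y]
      rw [← Real.rpow_add hy]
      congr 1
      ring
    rw [← ofReal_integral_eq_lintegral_ofReal, h2, mul_comm (y ^ r), ENNReal.ofReal_mul hG.le,
      ← mul_assoc, ENNReal.inv_mul_cancel, one_mul]
    · simpa using hG
    · simp
    · exact not_imp_comm.1 integral_undef (by rw [h2]; positivity)
    · filter_upwards [ae_restrict_mem measurableSet_Ioi] with x hx
      have hx' : (0 : ℝ) < x := hx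
      simp only [Pi.zero_apply]
      positivity
  have h1 : ∫⁻ ω, ENNReal.ofReal (D 1 ω ^ r) ∂P = (ENNReal.ofReal (Real.Gamma (1 - r)))⁻¹ *
      ∫⁻ ω, (∫⁻ x in Set.Ioi (0 : ℝ),
        ENNReal.ofReal (x ^ (-r) * (D 1 ω * Real.exp (-(x * D 1 ω))))) ∂P := by
    rw [← lintegral_const_mul' _ _ (by simpa using hG)]
    refine lintegral_congr_ae ?_
    filter_upwards [hD.ae_pos hα] with ω hω using key _ hω
  rw [h1, lintegral_lintegral_swap (by fun_prop)]
  -- After Tonelli the inner expectation is minus the derivative of the Laplace transform at `x`.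
  have h2 : ∫⁻ x in Set.Ioi (0 : ℝ), ∫⁻ ω,
      ENNReal.ofReal (x ^ (-r) * (D 1 ω * Real.exp (-(x * D 1 ω)))) ∂P =
      ∫⁻ x in Set.Ioi (0 : ℝ), ENNReal.ofReal (α * (x ^ (α - 1 - r) * Real.exp (-x ^ α))) := by
    refine setLIntegral_congr_fun measurableSet_Ioi fun x hx ↦ ?_
    have hx' : (0 : ℝ) < x := hx
    obtain ⟨hi, he⟩ := hD.integral_mul_exp hx'
    rw [← ofReal_integral_eq_lintegral_ofReal (hi.const_mul _), integral_const_mul, he]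
    · congr 1
      rw [sub_eq_add_neg (α - 1) r, Real.rpow_add hx']
      ring
    · filter_upwards [hD.ae_nonneg] with ω h
      have := h 1
      simp only [Pi.zero_apply]
      positivity
  have h3 : ∫ x in Set.Ioi (0 : ℝ), α * (x ^ (α - 1 - r) * Real.exp (-x ^ α)) =
      Real.Gamma (1 - r / α) := by
    rw [integral_const_mul, integral_rpow_mul_exp_neg_rpow hα0 (by linarith), ← mul_assoc,
      mul_one_div_cancel hα0.ne', one_mul]
    congr 1
    field_simp
    ring
  have hG2 : 0 < Real.Gamma (1 - r / α) :=
    Real.Gamma_pos_of_pos (by rw [sub_pos, div_lt_one hα0]; exact hr)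
  rw [h2, ← ofReal_integral_eq_lintegral_ofReal, h3, div_eq_inv_mul (Real.Gamma _),
    ENNReal.ofReal_mul (by positivity), ENNReal.ofReal_inv_of_pos hG]
  · exact not_imp_comm.1 integral_undef (by rw [h3]; positivity)
  · filter_upwards [ae_restrict_mem measurableSet_Ioi] with x hx
    have hx' : (0 : ℝ) < x := hx
    simp only [Pi.zero_apply]
    positivity

end Subordinator

/-- Two finite measures on `ℝ` with interleaving tails coincide. -/
theorem MeasureTheory.Measure.ext_of_Ioi_le_Ici {μ ν : Measure ℝ} [IsFiniteMeasure μ]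
    [IsFiniteMeasure ν] (h₁ : ∀ r, μ (Set.Ioi r) ≤ ν (Set.Ici r))
    (h₂ : ∀ r, ν (Set.Ioi r) ≤ μ (Set.Ici r)) : μ = ν := by
  -- One half of an antisymmetry argument: `μ [a, ∞) ≤ μ (a - ε, ∞) ≤ ν [a - ε, ∞)`, and the last
  -- term decreases to `ν [a, ∞)` by continuity from above.
  have key : ∀ {μ ν : Measure ℝ} [IsFiniteMeasure ν],
      (∀ r, μ (Set.Ioi r) ≤ ν (Set.Ici r)) → ∀ a, μ (Set.Ici a) ≤ ν (Set.Ici a) := by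
    intro μ ν _ h a
    have hI : Set.Ici a = ⋂ n : ℕ, Set.Ici (a - 1 / ((n : ℝ) + 1)) := by
      ext x
      simp only [Set.mem_Ici, Set.mem_iInter]
      refine ⟨fun hx n ↦ ?_, fun hx ↦ ?_⟩
      · have : (0 : ℝ) < 1 / ((n : ℝ) + 1) := by positivity
        linarith
      · have : Tendsto (fun n : ℕ ↦ a - 1 / ((n : ℝ) + 1)) atTop (𝓝 (a - 0)) :=
          tendsto_const_nhds.sub tendsto_one_div_add_atTop_nhds_zero_nat
        rw [sub_zero] at this
        exact le_of_tendsto' this hx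
    have hlim : Tendsto (fun n : ℕ ↦ ν (Set.Ici (a - 1 / ((n : ℝ) + 1)))) atTop
        (𝓝 (ν (Set.Ici a))) := by
      rw [hI]
      refine tendsto_measure_iInter_atTop (fun n ↦ measurableSet_Ici.nullMeasurableSet) ?_
        ⟨0, measure_ne_top _ _⟩
      intro m n hmn
      refine Set.Ici_subset_Ici.2 (sub_le_sub_left ?_ a)
      exact one_div_le_one_div_of_le (by positivity) (by gcongr)
    refine ge_of_tendsto' hlim fun n ↦ (measure_mono ?_).trans (h _)
    have : (0 : ℝ) < 1 / ((n : ℝ) + 1) := by positivity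
    exact Set.Ici_subset_Ioi.2 (by linarith)
  exact Measure.ext_of_Ici _ _ fun a ↦ le_antisymm (key h₁ a) (key h₂ a)

/-! ### The first-passage inverse: overshoot law and potential measure -/

/-- With `le_inverseProcess` this gives `{r < Y t} ⊆ {D r ≤ t} ⊆ {r ≤ Y t}`. The mismatch between
strict and weak inequality is what `Measure.ext_of_Ioi_le_Ici` absorbs. -/
theorem le_of_lt_inverseProcess {Ω : Type*} {D : ℝ≥0 → Ω → ℝ} {t r : ℝ≥0} {ω : Ω}
    (h : r < inverseProcess D t ω) : D r ω ≤ t :=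
  not_lt.1 fun hc ↦ notMem_of_lt_csInf h (OrderBot.bddBelow _) hc

/-- A level `s` with `D s > t` cannot lie below `r`, by monotonicity. The hypothesis `hu` excludes
the default value `sInf ∅ = 0`. -/
theorem le_inverseProcess {Ω : Type*} {D : ℝ≥0 → Ω → ℝ} {t r : ℝ≥0} {ω : Ω}
    (hm : Monotone fun s ↦ D s ω) (hu : ∃ s, (t : ℝ) < D s ω) (h : D r ω ≤ t) :
    r ≤ inverseProcess D t ω :=
  le_csInf hu fun _ hs ↦ le_of_not_gt fun hc ↦ absurd (hm hc.le) (not_le.2 (h.trans_lt hs))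

section Inverse

variable {Ω : Type*} [MeasurableSpace Ω] {P : Measure Ω} [IsProbabilityMeasure P] {α : ℝ}
  {D : ℝ≥0 → Ω → ℝ}

/-- Chernoff's bound at parameter `-1`: `P(D n ≤ t) ≤ exp t * exp (-n)` for every `n`. -/
theorem IsStableSubordinator.ae_unbounded (hD : IsStableSubordinator α D P) (t : ℝ) :
    ∀ᵐ ω ∂P, ∃ s, t < D s ω := by
  have hle : ∀ n : ℕ, P.real {ω | ∀ s, D s ω ≤ t} ≤ Real.exp t * Real.exp (-n) := by
    intro n
    have h1 := hD.laplace n 1 one_pos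
    have h2 := measure_le_le_exp_mul_mgf (μ := P) (X := D n) (t := -1) t (by norm_num) ?_
    · refine (measureReal_mono fun ω (hω : ∀ s, D s ω ≤ t) ↦ hω n).trans (h2.trans_eq ?_)
      simp only [one_mul, Real.one_rpow, mul_one, NNReal.coe_natCast] at h1
      simp [mgf, h1]
    · refine not_imp_comm.1 integral_undef ?_
      simp only [one_mul] at h1
      simp only [neg_mul, one_mul, h1]
      positivity
  have hlim : Tendsto (fun n : ℕ ↦ Real.exp t * Real.exp (-n)) atTop (𝓝 0) := by
    simpa using (Real.tendsto_exp_neg_atTop_nhds_zero.comp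
      tendsto_natCast_atTop_atTop).const_mul (Real.exp t)
  have h0 := le_antisymm (ge_of_tendsto' hlim hle) measureReal_nonneg
  rw [measureReal_eq_zero_iff] at h0
  rw [ae_iff]
  simpa using h0

theorem IsStableSubordinator.ae_sandwich (hD : IsStableSubordinator α D P) (t : ℝ≥0) :
    ∀ᵐ ω ∂P, ∀ r, D r ω ≤ t → r ≤ inverseProcess D t ω := by
  filter_upwards [hD.mono, hD.ae_unbounded t] with ω h1 h2 r hr using le_inverseProcess h1 h2 hr

/-- Outside a null set, `Y t < r` holds exactly when `D q > t` for some rational time `q < r`, which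
replaces an uncountable infimum by a countable union. -/
theorem IsStableSubordinator.aemeasurable_inverseProcess (hD : IsStableSubordinator α D P)
    (t : ℝ≥0) : AEMeasurable (inverseProcess D t) P := by
  refine NullMeasurable.aemeasurable ?_
  have : @Measurable (NullMeasurableSpace Ω P) ℝ≥0 _ _ (inverseProcess D t) := by
    refine measurable_of_Iio fun r ↦ ?_
    have hms : MeasurableSet (⋃ (q : ℚ) (_ : Real.toNNReal q < r),
        {ω | (t : ℝ) < D (Real.toNNReal q) ω}) :=
      MeasurableSet.iUnion fun q ↦ MeasurableSet.iUnion fun _ ↦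
        measurableSet_lt measurable_const (hD.measurable _)
    have hns : NullMeasurableSet (inverseProcess D t ⁻¹' Set.Iio r) P := by
      refine hms.nullMeasurableSet.congr ?_
      filter_upwards [hD.ae_sandwich t] with ω h
      refine propext ⟨fun hω ↦ ?_, fun hω ↦ ?_⟩
      · obtain ⟨q, hq, hω⟩ := Set.mem_iUnion₂.1 hω
        refine lt_of_le_of_lt ?_ hq
        exact not_lt.1 fun hc ↦ absurd (le_of_lt_inverseProcess hc) (not_le.2 hω)
      · obtain ⟨q, -, h1, h2⟩ := (NNReal.lt_iff_exists_rat_btwn _ _).1 (show _ < r from hω)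
        refine Set.mem_iUnion₂.2 ⟨q, h2, ?_⟩
        exact not_le.1 fun hc ↦ absurd (h _ hc) (not_le.2 h1)
    exact hns
  exact this

theorem IsStableSubordinator.inverseProcess_mono (hD : IsStableSubordinator α D P) {s t : ℝ≥0}
    (hst : s ≤ t) : ∀ᵐ ω ∂P, inverseProcess D s ω ≤ inverseProcess D t ω := by
  filter_upwards [hD.ae_unbounded t] with ω h
  exact csInf_le_csInf (OrderBot.bddBelow _) h
    fun r hr ↦ lt_of_le_of_lt (NNReal.coe_le_coe.2 hst) hr

/-- The joint law of `D u` and of a later increment. -/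
theorem IsStableSubordinator.map_prod_increment (hα : α ∈ Set.Ioo (0 : ℝ) 1)
    (hD : IsStableSubordinator α D P) (u r : ℝ≥0) :
    P.map (fun ω ↦ (D u ω, D (u + r) ω - D u ω)) =
      ((P.map (D u)).prod (P.map (D 1))).map fun p ↦ (p.1, (r : ℝ) ^ (1 / α) * p.2) := by
  have hm := hD.measurable
  have h1 : (D u) ⟂ᵢ[P] (D (u + r) - D u) :=
    hD.indep_increments.indepFun_eval_sub zero_le le_self_add hD.zero
  have h2 := (indepFun_iff_map_prod_eq_prod_map_map (hm u).aemeasurable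
    ((hm (u + r)).sub (hm u)).aemeasurable).1 h1
  have h3 : P.map (D (u + r) - D u) = (P.map (D 1)).map fun x ↦ (r : ℝ) ^ (1 / α) * x := by
    rw [(hD.stationary_increments u r).map_eq, Measure.map_map (by fun_prop) (hm 1)]
    refine Eq.trans ?_ (hD.map_eq hα r)
    refine Measure.map_congr ?_
    filter_upwards [hD.zero] with ω h using by simp [h]
  have h4 := Measure.map_prod_map (P.map (D u)) (P.map (D 1)) (f := id) measurable_id
    (measurable_const_mul ((r : ℝ) ^ (1 / α)))
  rw [Measure.map_id] at h4
  calc _ = (P.map (D u)).prod (P.map (D (u + r) - D u)) := h2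
    _ = _ := by rw [h3]; exact h4

/-- On the event `s < D u ≤ t`, the overshoot `Y t - u` is distributed as `((t - D u) / D' 1) ^ α`
with `D' 1` an independent copy of `D 1`. -/
theorem IsStableSubordinator.map_inverseProcess_sub (hα : α ∈ Set.Ioo (0 : ℝ) 1)
    (hD : IsStableSubordinator α D P) (u t : ℝ≥0) (s : ℝ) :
    (P.restrict (D u ⁻¹' Set.Ioc s t)).map (fun ω ↦ (inverseProcess D t ω : ℝ) - u) =
      (((P.map (D u)).prod (P.map (D 1))).restrict (Prod.fst ⁻¹' Set.Ioc s t)).map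
        fun p : ℝ × ℝ ↦ (((t : ℝ) - p.1) / p.2) ^ α := by
  have hm := hD.measurable
  have hα0 := hα.1
  have : IsProbabilityMeasure (P.map (D u)) := Measure.isProbabilityMeasure_map (hm u).aemeasurable
  have : IsProbabilityMeasure (P.map (D 1)) := Measure.isProbabilityMeasure_map (hm 1).aemeasurable
  set Q := (P.map (D u)).prod (P.map (D 1))
  have hY : AEMeasurable (fun ω ↦ (inverseProcess D t ω : ℝ) - u)
      (P.restrict (D u ⁻¹' Set.Ioc s t)) :=
    ((hD.aemeasurable_inverseProcess t).coe_nnreal_real.sub_const _).restrict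
  have hW : Measurable fun p : ℝ × ℝ ↦ ((t - p.1) / p.2) ^ α := by fun_prop
  have hpos : ∀ᵐ p ∂Q, 0 < p.2 := by
    have : ∀ᵐ x ∂P.map (D 1), 0 < x :=
      (ae_map_iff (hm 1).aemeasurable measurableSet_Ioi).2 (hD.ae_pos hα)
    exact Measure.quasiMeasurePreserving_snd.ae this
  -- The event lying between `{Y t - u > r}` and `{Y t - u ≥ r}`. Writing the increment as `r ^
  -- (1/α) * x` and solving `D u + r ^ (1/α) * x ≤ t` for `r` gives the exact upper tail of the
  -- target law.
  have hA : ∀ r : ℝ, P {ω | s < D u ω ∧ D (u + r.toNNReal) ω ≤ t} =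
      (Q.restrict (Prod.fst ⁻¹' Set.Ioc s t)).map (fun p : ℝ × ℝ ↦ (((t : ℝ) - p.1) / p.2) ^ α) (Set.Ici r) := by
    intro r
    have h1 : P {ω | s < D u ω ∧ D (u + r.toNNReal) ω ≤ t} =
        P.map (fun ω ↦ (D u ω, D (u + r.toNNReal) ω - D u ω)) {p | s < p.1 ∧ p.1 + p.2 ≤ t} := by
      rw [Measure.map_apply (show Measurable fun ω ↦ (D u ω, D (u + r.toNNReal) ω - D u ω) from
        (hm u).prodMk ((hm _).sub (hm u)))]
      · simp
      · exact (measurableSet_lt measurable_const measurable_fst).inter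
          (measurableSet_le (measurable_fst.add measurable_snd) measurable_const)
    rw [h1, hD.map_prod_increment hα, Measure.map_apply hW measurableSet_Ici,
      Measure.restrict_apply (hW measurableSet_Ici), Measure.map_apply (by fun_prop)]
    · refine measure_congr ?_
      filter_upwards [hpos] with p hp
      refine propext ?_
      change (s < p.1 ∧ p.1 + (r.toNNReal : ℝ) ^ (1 / α) * p.2 ≤ t) ↔
        (r ≤ ((t - p.1) / p.2) ^ α ∧ s < p.1 ∧ p.1 ≤ t)
      have hr : (0 : ℝ) ≤ r.toNNReal := NNReal.coe_nonneg _
      have key : p.1 ≤ t → (r ≤ ((t - p.1) / p.2) ^ α ↔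
          p.1 + (r.toNNReal : ℝ) ^ (1 / α) * p.2 ≤ t) := by
        intro hpt
        have hq : 0 ≤ (t - p.1) / p.2 := div_nonneg (by linarith) hp.le
        -- Truncating a negative `r` to `0` changes nothing, because the right-hand side is
        -- nonnegative.
        have e1 : r ≤ ((t - p.1) / p.2) ^ α ↔ (r.toNNReal : ℝ) ≤ ((t - p.1) / p.2) ^ α := by
          rw [Real.coe_toNNReal']
          simp [Real.rpow_nonneg hq]
        rw [e1, ← Real.rpow_inv_le_iff_of_pos hr hq hα0, le_div_iff₀ hp, inv_eq_one_div]
        constructor <;> intro h <;> linarith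
      constructor
      · rintro ⟨h1, h2⟩
        have h3 : p.1 ≤ t := by
          have : 0 ≤ (r.toNNReal : ℝ) ^ (1 / α) * p.2 := by positivity
          linarith
        exact ⟨(key h3).2 h2, h1, h3⟩
      · rintro ⟨h1, h2, h3⟩
        exact ⟨h2, (key h3).1 h1⟩
    · exact (measurableSet_lt measurable_const measurable_fst).inter
          (measurableSet_le (measurable_fst.add measurable_snd) measurable_const)
  have hE : MeasurableSet (D u ⁻¹' Set.Ioc s t) := hm u measurableSet_Ioc
  refine Measure.ext_of_Ioi_le_Ici (fun r ↦ ?_) fun r ↦ ?_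
  -- Both tail comparisons pass through the event of `hA`: the strict tail of `Y t - u` is contained
  -- in it, and it is almost surely contained in the weak tail.
  · rw [← hA, Measure.map_apply_of_aemeasurable hY measurableSet_Ioi,
      Measure.restrict_apply' hE]
    refine measure_mono ?_
    rintro ω ⟨h1, h2, h3⟩
    refine ⟨h2, ?_⟩
    rcases le_or_gt r 0 with hr | hr
    · simpa [Real.toNNReal_of_nonpos hr] using h3
    · refine le_of_lt_inverseProcess ?_
      have h1' : r < (inverseProcess D t ω : ℝ) - u := h1
      rw [← NNReal.coe_lt_coe, NNReal.coe_add, Real.coe_toNNReal r hr.le]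
      linarith
  · refine (measure_mono Set.Ioi_subset_Ici_self).trans ?_
    rw [← hA, Measure.map_apply_of_aemeasurable hY measurableSet_Ici,
      Measure.restrict_apply' hE]
    refine measure_mono_ae ?_
    filter_upwards [hD.ae_sandwich t, hD.mono] with ω h hmono
    rintro ⟨h1, h2⟩
    refine ⟨?_, h1, (hmono le_self_add).trans h2⟩
    have := NNReal.coe_le_coe.2 (h _ h2)
    rw [NNReal.coe_add] at this
    have h4 := Real.le_coe_toNNReal r
    change r ≤ (inverseProcess D t ω : ℝ) - u
    linarith

/-- The moment constant `E[Y(1) ^ γ]`. -/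
noncomputable def inverseMoment (α γ : ℝ) : ℝ :=
  Real.Gamma (1 + γ) / Real.Gamma (1 + α * γ)

/-- Under the product law the independent factor contributes `E[D(1)^(-αγ)]`, the stable moment of
order `r = -αγ`. The condition `γ > -1` is exactly `r < α`. -/
theorem IsStableSubordinator.setLIntegral_rpow_sub (hα : α ∈ Set.Ioo (0 : ℝ) 1)
    (hD : IsStableSubordinator α D P) (u t : ℝ≥0) (s : ℝ) {γ : ℝ} (hγ : -1 < γ) :
    ∫⁻ ω in D u ⁻¹' Set.Ioc s t, ENNReal.ofReal (((inverseProcess D t ω : ℝ) - u) ^ γ) ∂P =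
      ENNReal.ofReal (inverseMoment α γ) *
        ∫⁻ ω in D u ⁻¹' Set.Ioc s t, ENNReal.ofReal ((t - D u ω) ^ (α * γ)) ∂P := by
  have hm := hD.measurable
  have hα0 := hα.1
  have : IsProbabilityMeasure (P.map (D u)) := Measure.isProbabilityMeasure_map (hm u).aemeasurable
  have : IsProbabilityMeasure (P.map (D 1)) := Measure.isProbabilityMeasure_map (hm 1).aemeasurable
  have hY : AEMeasurable (fun ω ↦ (inverseProcess D t ω : ℝ) - u)
      (P.restrict (D u ⁻¹' Set.Ioc s t)) :=
    ((hD.aemeasurable_inverseProcess t).coe_nnreal_real.sub_const _).restrict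
  have hf : Measurable fun x : ℝ ↦ ENNReal.ofReal (x ^ γ) := by fun_prop
  have hpos : ∀ᵐ x ∂P.map (D 1), 0 < x :=
    (ae_map_iff (hm 1).aemeasurable measurableSet_Ioi).2 (hD.ae_pos hα)
  have hmom : ∫⁻ x, ENNReal.ofReal (x ^ (-(α * γ))) ∂P.map (D 1) =
      ENNReal.ofReal (inverseMoment α γ) := by
    rw [lintegral_map (by fun_prop) (hm 1), hD.lintegral_rpow hα (by nlinarith), inverseMoment]
    congr 3
    · field_simp; ring
    · ring
  have hsplit : (Prod.fst ⁻¹' Set.Ioc s t : Set (ℝ × ℝ)) = Set.Ioc s t ×ˢ Set.univ := by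
    ext; simp
  have hback : ∫⁻ y in Set.Ioc s t, ENNReal.ofReal ((t - y) ^ (α * γ)) ∂P.map (D u) =
      ∫⁻ ω in D u ⁻¹' Set.Ioc s t, ENNReal.ofReal ((t - D u ω) ^ (α * γ)) ∂P :=
    setLIntegral_map measurableSet_Ioc (by fun_prop) (hm u)
  rw [← lintegral_map' hf.aemeasurable hY, hD.map_inverseProcess_sub hα u t s,
    lintegral_map hf (by fun_prop), hsplit, ← Measure.prod_restrict, Measure.restrict_univ,
    lintegral_prod _ (by fun_prop), ← hback, ← lintegral_const_mul' _ _ ENNReal.ofReal_ne_top]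
  refine setLIntegral_congr_fun measurableSet_Ioc fun y hy ↦ ?_
  have hy' : 0 ≤ (t : ℝ) - y := sub_nonneg.2 hy.2
  rw [← hmom, ← lintegral_mul_const' _ _ ENNReal.ofReal_ne_top]
  refine lintegral_congr_ae ?_
  filter_upwards [hpos] with x hx
  have hx' : 0 < x := hx
  rw [← ENNReal.ofReal_mul (by positivity), ← Real.rpow_mul (by positivity), Real.div_rpow hy' hx'.le,
    Real.rpow_neg hx'.le, mul_comm, div_eq_mul_inv, mul_comm]

theorem IsStableSubordinator.lintegral_inverseProcess_rpow (hα : α ∈ Set.Ioo (0 : ℝ) 1)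
    (hD : IsStableSubordinator α D P) (t : ℝ≥0) {γ : ℝ} (hγ : -1 < γ) :
    ∫⁻ ω, ENNReal.ofReal ((inverseProcess D t ω : ℝ) ^ γ) ∂P =
      ENNReal.ofReal (inverseMoment α γ * (t : ℝ) ^ (α * γ)) := by
  -- At `u = 0` the overshoot is `Y t` itself. As `D 0 = 0` almost surely, any negative lower bound
  -- makes the event full; the bound `0` would make it null.
  have h := hD.setLIntegral_rpow_sub hα 0 t (-1) hγ
  have hE : (D 0 ⁻¹' Set.Ioc (-1) (t : ℝ)) =ᵐ[P] Set.univ := by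
    rw [eventuallyEq_univ]
    filter_upwards [hD.zero] with ω h0
    simp [h0]
  rw [setLIntegral_congr hE, setLIntegral_congr hE, setLIntegral_univ, setLIntegral_univ] at h
  have hc : 0 ≤ inverseMoment α γ :=
    div_nonneg (Real.Gamma_pos_of_pos (by linarith)).le
      (Real.Gamma_pos_of_pos (by nlinarith [hα.1, hα.2])).le
  simp only [NNReal.coe_zero, sub_zero] at h
  rw [h, ENNReal.ofReal_mul hc]
  congr 1
  have : ∀ᵐ ω ∂P, ENNReal.ofReal (((t : ℝ) - D 0 ω) ^ (α * γ)) =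
      ENNReal.ofReal ((t : ℝ) ^ (α * γ)) := by
    filter_upwards [hD.zero] with ω h0
    simp [h0]
  rw [lintegral_congr_ae this]
  simp

/-- The potential measure of a standard `α`-stable subordinator. -/
theorem IsStableSubordinator.lintegral_potential (hα : α ∈ Set.Ioo (0 : ℝ) 1)
    (hD : IsStableSubordinator α D P) {g : ℝ → ℝ≥0∞} (hg : Measurable g) :
    ∫⁻ u in Set.Ioi (0 : ℝ), (∫⁻ ω, g (D u.toNNReal ω) ∂P) =
      ∫⁻ y in Set.Ioi (0 : ℝ), ENNReal.ofReal (y ^ (α - 1) / Real.Gamma α) * g y := by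
  have hm := hD.measurable
  have hα0 := hα.1
  have h1 : ∫⁻ u in Set.Ioi (0 : ℝ), (∫⁻ ω, g (D u.toNNReal ω) ∂P) =
      ∫⁻ u in Set.Ioi (0 : ℝ), (∫⁻ ω, g (u ^ (1 / α) * D 1 ω) ∂P) := by
    refine setLIntegral_congr_fun measurableSet_Ioi fun u hu ↦ ?_
    have hu' : (0 : ℝ) < u := hu
    rw [← lintegral_map hg (hm _), hD.map_eq hα, lintegral_map hg (by fun_prop),
      Real.coe_toNNReal u hu'.le]
  -- The substitution `u = z ^ (-α) * y ^ α` separates the dependence on `z = D 1` from the integral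
  -- over space.
  have h2 : ∀ z : ℝ, 0 < z → ∫⁻ u in Set.Ioi (0 : ℝ), g (u ^ (1 / α) * z) =
      ENNReal.ofReal (z ^ (-α)) * ∫⁻ y in Set.Ioi (0 : ℝ), ENNReal.ofReal (α * y ^ (α - 1)) * g y := by
    intro z hz
    have himg : (fun y : ℝ ↦ z ^ (-α) * y ^ α) '' Set.Ioi 0 = Set.Ioi 0 := by
      ext x
      simp only [Set.mem_image, Set.mem_Ioi]
      constructor
      · rintro ⟨y, hy, rfl⟩; positivity
      · intro hx
        refine ⟨x ^ (1 / α) * z, by positivity, ?_⟩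
        rw [Real.mul_rpow (by positivity) hz.le, ← Real.rpow_mul hx.le,
          one_div_mul_cancel hα0.ne', Real.rpow_one, mul_left_comm, ← Real.rpow_add hz]
        simp
    have hinv : ∀ y : ℝ, 0 < y → (z ^ (-α) * y ^ α) ^ (1 / α) * z = y := by
      intro y hy
      rw [Real.mul_rpow (by positivity) (by positivity), ← Real.rpow_mul hy.le,
        ← Real.rpow_mul hz.le, mul_one_div_cancel hα0.ne', Real.rpow_one, neg_mul,
        mul_one_div_cancel hα0.ne', Real.rpow_neg_one]
      field_simp
    rw [← himg, lintegral_image_eq_lintegral_abs_deriv_mul measurableSet_Ioi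
      (f' := fun y ↦ z ^ (-α) * (α * y ^ (α - 1)))]
    · rw [himg, ← lintegral_const_mul' _ _ ENNReal.ofReal_ne_top]
      refine setLIntegral_congr_fun measurableSet_Ioi fun y hy ↦ ?_
      have hy' : (0 : ℝ) < y := hy
      rw [hinv y hy', abs_of_pos (by positivity), ENNReal.ofReal_mul (by positivity), mul_assoc]
    · intro y hy
      exact ((Real.hasDerivAt_rpow_const (Or.inl (ne_of_gt hy))).const_mul _).hasDerivWithinAt
    · intro a ha b hb hab
      rw [← hinv a ha, ← hinv b hb]
      simp only at hab
      rw [hab]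
  rw [h1, ← lintegral_lintegral_swap (by fun_prop)]
  have h3 : ∫⁻ ω, (∫⁻ u in Set.Ioi (0 : ℝ), g (u ^ (1 / α) * D 1 ω)) ∂P =
      ∫⁻ ω, ENNReal.ofReal (D 1 ω ^ (-α)) *
        (∫⁻ y in Set.Ioi (0 : ℝ), ENNReal.ofReal (α * y ^ (α - 1)) * g y) ∂P := by
    refine lintegral_congr_ae ?_
    filter_upwards [hD.ae_pos hα] with ω hω using h2 _ hω
  have hG : 0 < Real.Gamma α := Real.Gamma_pos_of_pos hα0
  rw [h3, lintegral_mul_const _ (by fun_prop), hD.lintegral_rpow hα (by linarith),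
    ← lintegral_const_mul' _ _ ENNReal.ofReal_ne_top]
  refine setLIntegral_congr_fun measurableSet_Ioi fun y hy ↦ ?_
  have hy' : (0 : ℝ) < y := hy
  -- The stable moment of order `-α` is `Γ(2) / Γ(1 + α) = 1 / (α Γ(α))`; its `α` cancels the one
  -- from the Jacobian.
  have e1 : Real.Gamma (1 - -α) = α * Real.Gamma α := by
    rw [sub_neg_eq_add, add_comm, Real.Gamma_add_one hα0.ne']
  have e2 : Real.Gamma (1 - -α / α) = 1 := by
    rw [neg_div, div_self hα0.ne', sub_neg_eq_add, one_add_one_eq_two, Real.Gamma_two]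
  rw [← mul_assoc, e1, e2, ← ENNReal.ofReal_mul (by positivity)]
  congr 2
  field_simp

end Inverse

/-! ### Incomplete Beta integrals and their asymptotics -/

section IncompleteBeta

theorem incompleteBeta_one {a b : ℝ} (ha : 0 < a) (hb : 0 < b) : incompleteBeta a b 1 = beta a b := by
  rw [beta_eq_betaIntegralReal a b ha hb, Complex.betaIntegral, incompleteBeta,
    intervalIntegral.integral_of_le zero_le_one, intervalIntegral.integral_of_le zero_le_one,
    ← RCLike.re_to_complex, ← integral_re]
  · refine setIntegral_congr_fun measurableSet_Ioc fun x ⟨hx1, hx2⟩ ↦ ?_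
    norm_cast
    rw [← Complex.ofReal_cpow, ← Complex.ofReal_cpow, RCLike.re_to_complex,
      Complex.re_mul_ofReal, Complex.ofReal_re]
    all_goals linarith
  · convert! Complex.betaIntegral_convergent (u := a) (v := b) (by simpa) (by simpa)
    rw [intervalIntegrable_iff_integrableOn_Ioc_of_le (by simp), IntegrableOn]

theorem intervalIntegrable_incompleteBeta {a b : ℝ} (ha : 0 < a) (hb : 0 < b) {w z : ℝ}
    (hw : w ∈ Set.Icc (0 : ℝ) 1) (hz : z ∈ Set.Icc (0 : ℝ) 1) :
    IntervalIntegrable (fun u ↦ u ^ (a - 1) * (1 - u) ^ (b - 1)) volume w z := by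
  have h : IntervalIntegrable (fun u ↦ u ^ (a - 1) * (1 - u) ^ (b - 1)) volume 0 1 := by
    -- Integrability up to both singular endpoints is read off from the nonzero value of the
    -- complete Beta integral.
    refine intervalIntegral.intervalIntegrable_of_integral_ne_zero ?_
    have := incompleteBeta_one ha hb
    rw [incompleteBeta] at this
    rw [this]
    exact (beta_pos ha hb).ne'
  refine h.mono_set ?_
  rw [Set.uIcc_of_le zero_le_one]
  exact Set.uIcc_subset_Icc hw hz

/-- The unnormalised form of an incomplete Beta integral. -/
theorem rpow_mul_integral_beta (a b : ℝ) {t w s : ℝ} (ht : 0 < t) (hw0 : 0 ≤ w) (hwt : w ≤ t)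
    (hs0 : 0 ≤ s) (hst : s ≤ t) :
    ∫ y in w..s, (t - y) ^ (b - 1) * y ^ (a - 1) =
      t ^ (a + b - 1) * ∫ u in (w / t)..(s / t), u ^ (a - 1) * (1 - u) ^ (b - 1) := by
  have h := intervalIntegral.integral_comp_div (a := w) (b := s)
    (fun u ↦ u ^ (a - 1) * (1 - u) ^ (b - 1)) ht.ne'
  rw [smul_eq_mul] at h
  rw [show a + b - 1 = (a + b - 2) + 1 by ring, Real.rpow_add_one ht.ne', mul_assoc, ← h,
    ← intervalIntegral.integral_const_mul]
  refine intervalIntegral.integral_congr fun y hy ↦ ?_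
  have hy0 : 0 ≤ y := le_trans (le_min hw0 hs0) hy.1
  have hyt : y ≤ t := hy.2.trans (max_le hwt hst)
  rw [one_sub_div ht.ne', Real.div_rpow hy0 ht.le, Real.div_rpow (sub_nonneg.2 hyt) ht.le,
    show a + b - 2 = (a - 1) + (b - 1) by ring, Real.rpow_add ht]
  have h1 : 0 < t ^ (a - 1) := by positivity
  have h2 : 0 < t ^ (b - 1) := by positivity
  field_simp

theorem rpow_mul_incompleteBeta (a b : ℝ) {t s : ℝ} (ht : 0 < t) (hs0 : 0 ≤ s) (hst : s ≤ t) :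
    t ^ (a + b - 1) * incompleteBeta a b (s / t) =
      ∫ y in (0 : ℝ)..s, (t - y) ^ (b - 1) * y ^ (a - 1) := by
  rw [rpow_mul_integral_beta a b ht le_rfl ht.le hs0 hst, zero_div, incompleteBeta]

theorem intervalIntegrable_beta {a b : ℝ} (ha : 0 < a) (hb : 0 < b) {t w s : ℝ} (ht : 0 < t)
    (hw0 : 0 ≤ w) (hwt : w ≤ t) (hs0 : 0 ≤ s) (hst : s ≤ t) :
    IntervalIntegrable (fun y ↦ (t - y) ^ (b - 1) * y ^ (a - 1)) volume w s := by
  have h : IntervalIntegrable (fun y ↦ (t - y) ^ (b - 1) * y ^ (a - 1)) volume 0 t := by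
    refine intervalIntegral.intervalIntegrable_of_integral_ne_zero ?_
    rw [← rpow_mul_incompleteBeta a b ht ht.le le_rfl, div_self ht.ne', incompleteBeta_one ha hb]
    have := beta_pos ha hb
    positivity
  refine h.mono_set ?_
  rw [Set.uIcc_of_le ht.le]
  exact Set.uIcc_subset_Icc ⟨hw0, hwt⟩ ⟨hs0, hst⟩

theorem setLIntegral_beta {a b : ℝ} (ha : 0 < a) (hb : 0 < b) {t s : ℝ} (ht : 0 < t)
    (hs0 : 0 ≤ s) (hst : s ≤ t) :
    ∫⁻ y in Set.Ioc s t, ENNReal.ofReal ((t - y) ^ (b - 1) * y ^ (a - 1)) =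
      ENNReal.ofReal (t ^ (a + b - 1) * (beta a b - incompleteBeta a b (s / t))) := by
  have hi := intervalIntegrable_beta ha hb ht hs0 hst ht.le le_rfl
  rw [intervalIntegrable_iff_integrableOn_Ioc_of_le hst] at hi
  rw [← ofReal_integral_eq_lintegral_ofReal hi, ← intervalIntegral.integral_of_le hst,
    rpow_mul_integral_beta a b ht hs0 hst ht.le le_rfl, div_self ht.ne', ← incompleteBeta_one ha hb,
    incompleteBeta, incompleteBeta, intervalIntegral.integral_interval_sub_left]
  · exact intervalIntegrable_incompleteBeta ha hb ⟨le_rfl, zero_le_one⟩ ⟨zero_le_one, le_rfl⟩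
  · exact intervalIntegrable_incompleteBeta ha hb ⟨le_rfl, zero_le_one⟩
      ⟨by positivity, (div_le_one ht).2 hst⟩
  · filter_upwards [ae_restrict_mem measurableSet_Ioc] with y hy
    have h1 : 0 ≤ t - y := sub_nonneg.2 hy.2
    have h2 : 0 ≤ y := hs0.trans hy.1.le
    simp only [Pi.zero_apply]
    positivity

theorem incompleteBeta_nonneg (a b : ℝ) {z : ℝ} (hz : z ∈ Set.Icc (0 : ℝ) 1) :
    0 ≤ incompleteBeta a b z := by
  refine intervalIntegral.integral_nonneg hz.1 fun u hu ↦ ?_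
  have : 0 ≤ 1 - u := sub_nonneg.2 (hu.2.trans hz.2)
  have := hu.1
  positivity

/-- Differentiability at `0` gives `(1 - u) ^ (b - 1) = 1 + O(u)`; integrating this against `u ^ (a
- 1)` gains one power in the error. -/
theorem incompleteBeta_sub_isBigO {a b : ℝ} (ha : 0 < a) (hb : 0 < b) :
    (fun z ↦ incompleteBeta a b z - z ^ a / a) =O[𝓝[>] 0] fun z ↦ z ^ (a + 1) := by
  have hder : HasDerivAt (fun u : ℝ ↦ (1 - u) ^ (b - 1)) (-1 * (b - 1) * (1 - 0) ^ (b - 1 - 1)) 0 :=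
    (((hasDerivAt_id (0 : ℝ)).const_sub 1)).rpow_const (Or.inl (by simp))
  have hO := hder.isBigO_sub
  obtain ⟨K, hK⟩ := hO.bound
  obtain ⟨ε, hε, hball⟩ := Metric.eventually_nhds_iff.1 hK
  refine IsBigO.of_bound (|K| / (a + 1)) ?_
  have hmem : Set.Ioo (0 : ℝ) (min ε 1) ∈ 𝓝[>] (0 : ℝ) := Ioo_mem_nhdsGT (by positivity)
  filter_upwards [hmem] with z hz
  have hz1 : z < 1 := hz.2.trans_le (min_le_right _ _)
  have hzε : z < ε := hz.2.trans_le (min_le_left _ _)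
  have hz0 := hz.1
  have hpow : ∫ u in (0 : ℝ)..z, u ^ (a - 1) = z ^ a / a := by
    rw [integral_rpow (Or.inl (by linarith)), sub_add_cancel, Real.zero_rpow ha.ne', sub_zero]
  have hpow' : ∫ u in (0 : ℝ)..z, |K| * u ^ a = |K| / (a + 1) * z ^ (a + 1) := by
    rw [intervalIntegral.integral_const_mul, integral_rpow (Or.inl (by linarith)),
      Real.zero_rpow (by linarith), sub_zero]
    ring
  rw [← hpow, incompleteBeta, ← intervalIntegral.integral_sub
    (intervalIntegrable_incompleteBeta ha hb ⟨le_rfl, zero_le_one⟩ ⟨hz0.le, hz1.le⟩)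
    (intervalIntegral.intervalIntegrable_rpow' (by linarith)),
    Real.norm_of_nonneg (show 0 ≤ z ^ (a + 1) by positivity), ← hpow']
  refine intervalIntegral.norm_integral_le_of_norm_le hz0.le ?_
    ((intervalIntegral.intervalIntegrable_rpow' (by linarith)).const_mul _)
  refine ae_of_all _ fun u hu ↦ ?_
  have hu0 := hu.1
  have h1 := hball (y := u) (by
    rw [Real.dist_eq, sub_zero, abs_of_pos hu0]; exact hu.2.trans_lt hzε)
  simp only [sub_zero, Real.one_rpow, Real.norm_eq_abs, abs_of_pos hu0] at h1
  have h2 : |(1 - u) ^ (b - 1) - 1| ≤ |K| * u :=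
    h1.trans (mul_le_mul_of_nonneg_right (le_abs_self K) hu0.le)
  have h3 : u ^ (a - 1) * (1 - u) ^ (b - 1) - u ^ (a - 1) =
      u ^ (a - 1) * ((1 - u) ^ (b - 1) - 1) := by ring
  have h4 : u ^ a = u ^ (a - 1) * u := by
    rw [← Real.rpow_add_one hu0.ne', sub_add_cancel]
  rw [h3, norm_mul, Real.norm_eq_abs, Real.norm_eq_abs, abs_of_nonneg (by positivity), h4]
  calc _ ≤ u ^ (a - 1) * (|K| * u) := by gcongr
    _ = _ := by ring

/-- By the mean value theorem the bracket is `δ t ξ ^ (δ - 1)` with `ξ` between `v - t` and `v + t`.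
Divided by `δ t v ^ (δ - 1)` it is squeezed, uniformly in `y`, between two quantities tending to
`1`. Working with the quotient makes the sign of `δ` irrelevant, and `δ < 1` fixes the direction of
the bounds. -/
theorem integral_rpow_increment_isEquivalent {a δ t : ℝ} (ha : 0 < a) (hδ : δ ≠ 0) (hδ1 : δ < 1)
    (ht : 0 < t) :
    (fun v : ℝ ↦ ∫ y in (0 : ℝ)..t, ((t + v - y) ^ δ - (v - y) ^ δ) * y ^ (a - 1)) ~[atTop]
      fun v ↦ δ * t ^ (a + 1) / a * v ^ (δ - 1) := by
  have hmean : ∀ v y : ℝ, t < v → y ∈ Set.Icc 0 t →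
      ((t + v - y) ^ δ - (v - y) ^ δ) / (δ * t * v ^ (δ - 1)) ∈
        Set.Icc (((v + t) / v) ^ (δ - 1)) (((v - t) / v) ^ (δ - 1)) := by
    intro v y hv hy
    have hv0 : 0 < v := ht.trans hv
    obtain ⟨ξ, hξ, he⟩ := exists_hasDerivAt_eq_slope (fun x : ℝ ↦ x ^ δ)
      (fun x ↦ δ * x ^ (δ - 1)) (show v - y < t + v - y by linarith)
      (continuousOn_of_forall_continuousAt fun x hx ↦ Real.continuousAt_rpow_const _ _
        (Or.inl (by linarith [hx.1, hy.2])))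
      (fun x hx ↦ Real.hasDerivAt_rpow_const (Or.inl (by linarith [hx.1, hy.2])))
    have hξ0 : v - t ≤ ξ := by linarith [hξ.1, hy.2]
    have hξ1 : ξ ≤ v + t := by linarith [hξ.2, hy.1]
    rw [show t + v - y - (v - y) = t by ring, eq_div_iff ht.ne'] at he
    have hquot : ((t + v - y) ^ δ - (v - y) ^ δ) / (δ * t * v ^ (δ - 1)) = (ξ / v) ^ (δ - 1) := by
      have hp : 0 < v ^ (δ - 1) := by positivity
      rw [← he, Real.div_rpow (by linarith) hv0.le]
      field_simp
    rw [hquot]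
    have h1 : 0 < (v - t) / v := div_pos (by linarith) hv0
    have h2 : 0 < ξ / v := div_pos (by linarith) hv0
    exact ⟨Real.rpow_le_rpow_of_nonpos h2 (by gcongr) (by linarith),
      Real.rpow_le_rpow_of_nonpos h1 (by gcongr) (by linarith)⟩
  have hpow : ∫ y in (0 : ℝ)..t, y ^ (a - 1) = t ^ a / a := by
    rw [integral_rpow (Or.inl (by linarith)), sub_add_cancel, Real.zero_rpow ha.ne', sub_zero]
  have hpi : IntervalIntegrable (fun y : ℝ ↦ y ^ (a - 1)) volume 0 t :=
    intervalIntegral.intervalIntegrable_rpow' (by linarith)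
  have hbounds : ∀ᶠ v in atTop,
      (∫ y in (0 : ℝ)..t, ((t + v - y) ^ δ - (v - y) ^ δ) * y ^ (a - 1)) /
        (δ * t ^ (a + 1) / a * v ^ (δ - 1)) ∈
          Set.Icc (((v + t) / v) ^ (δ - 1)) (((v - t) / v) ^ (δ - 1)) := by
    filter_upwards [eventually_gt_atTop t] with v hv
    have hv0 : 0 < v := ht.trans hv
    have hp : 0 < v ^ (δ - 1) := by positivity
    have hta : 0 < t ^ a := by positivity
    have hint : IntervalIntegrable (fun y : ℝ ↦
        ((t + v - y) ^ δ - (v - y) ^ δ) / (δ * t * v ^ (δ - 1)) * y ^ (a - 1)) volume 0 t := by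
      refine hpi.continuousOn_mul ?_
      rw [Set.uIcc_of_le ht.le]
      refine ContinuousOn.div_const (ContinuousOn.sub ?_ ?_) _
      · exact ContinuousOn.rpow_const (by fun_prop) fun x hx ↦ Or.inl (by linarith [hx.2])
      · exact ContinuousOn.rpow_const (by fun_prop) fun x hx ↦ Or.inl (by linarith [hx.2])
    have hq : (∫ y in (0 : ℝ)..t, ((t + v - y) ^ δ - (v - y) ^ δ) * y ^ (a - 1)) /
        (δ * t ^ (a + 1) / a * v ^ (δ - 1)) =
        (∫ y in (0 : ℝ)..t, ((t + v - y) ^ δ - (v - y) ^ δ) / (δ * t * v ^ (δ - 1)) * y ^ (a - 1)) /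
          (t ^ a / a) := by
      have : ∀ y : ℝ, ((t + v - y) ^ δ - (v - y) ^ δ) / (δ * t * v ^ (δ - 1)) * y ^ (a - 1) =
          (δ * t * v ^ (δ - 1))⁻¹ * (((t + v - y) ^ δ - (v - y) ^ δ) * y ^ (a - 1)) :=
        fun y ↦ by ring
      simp_rw [this]
      rw [intervalIntegral.integral_const_mul, Real.rpow_add_one ht.ne']
      field_simp
    rw [hq, Set.mem_Icc, le_div_iff₀ (by positivity), div_le_iff₀ (by positivity), ← hpow,
      ← intervalIntegral.integral_const_mul, ← intervalIntegral.integral_const_mul]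
    constructor
    · refine intervalIntegral.integral_mono_on ht.le (hpi.const_mul _) hint fun y hy ↦ ?_
      have := hy.1
      exact mul_le_mul_of_nonneg_right (hmean v y hv hy).1 (by positivity)
    · refine intervalIntegral.integral_mono_on ht.le hint (hpi.const_mul _) fun y hy ↦ ?_
      have := hy.1
      exact mul_le_mul_of_nonneg_right (hmean v y hv hy).2 (by positivity)
  have hlim : ∀ c : ℝ, Tendsto (fun v : ℝ ↦ ((v + c) / v) ^ (δ - 1)) atTop (𝓝 1) := by
    intro c
    have h1 : Tendsto (fun v : ℝ ↦ 1 + c / v) atTop (𝓝 (1 + 0)) :=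
      tendsto_const_nhds.add (tendsto_const_nhds.div_atTop tendsto_id)
    rw [add_zero] at h1
    have h2 := h1.rpow_const (p := δ - 1) (Or.inl one_ne_zero)
    rw [Real.one_rpow] at h2
    refine h2.congr' ?_
    filter_upwards [eventually_gt_atTop 0] with v hv
    rw [add_div, div_self hv.ne']
  refine (isEquivalent_iff_tendsto_one ?_).2 ?_
  · filter_upwards [eventually_gt_atTop 0] with v hv
    have hp : 0 < v ^ (δ - 1) := by positivity
    have hta : 0 < t ^ (a + 1) := by positivity
    positivity
  · exact tendsto_of_tendsto_of_tendsto_of_le_of_le' (hlim t) (hlim (-t))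
      (hbounds.mono fun v h ↦ h.1) (hbounds.mono fun v h ↦ by rw [← sub_eq_add_neg]; exact h.2)

end IncompleteBeta

/-! ### Mittag-Leffler convergence, Gaussian moments, integrability tools -/

/-- Restrict the Gamma integral to `(M, ∞)`, where `x ^ q ≥ M ^ q`. With `M` free, this shows that
Gamma outgrows any geometric sequence. -/
theorem rpow_mul_exp_neg_le_Gamma {q M : ℝ} (hq : 0 ≤ q) (hM : 0 < M) :
    M ^ q * Real.exp (-M) ≤ Real.Gamma (q + 1) := by
  have hs : 0 < q + 1 := by linarith
  have hi := Real.GammaIntegral_convergent hs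
  rw [Real.Gamma_eq_integral hs]
  rw [add_sub_cancel_right] at hi ⊢
  calc M ^ q * Real.exp (-M) = ∫ x in Set.Ioi M, M ^ q * Real.exp (-x) := by
        rw [integral_const_mul, integral_exp_neg_Ioi]
    _ ≤ ∫ x in Set.Ioi M, Real.exp (-x) * x ^ q := by
        refine setIntegral_mono_on ((integrableOn_exp_neg_Ioi M).const_mul _)
          (hi.mono_set (Set.Ioi_subset_Ioi hM.le)) measurableSet_Ioi fun x hx ↦ ?_
        rw [mul_comm]
        have : M < x := hx
        gcongr
    _ ≤ _ := by
        refine setIntegral_mono_set hi ?_ (Set.Ioi_subset_Ioi hM.le).eventuallyLE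
        filter_upwards [ae_restrict_mem measurableSet_Ioi] with x hx
        have : (0 : ℝ) < x := hx
        simp only [Pi.zero_apply]
        positivity

/-- The Mittag-Leffler series converges. -/
theorem summable_pow_div_Gamma {α c : ℝ} (hα : 0 < α) (hc : 0 ≤ c) :
    Summable fun k : ℕ ↦ c ^ k / Real.Gamma (α * k + 1) := by
  -- Chosen so that `M ^ α = 2 (c + 1)`. Then `Γ(αk + 1) ≥ (2 (c + 1)) ^ k * exp (-M)`, and the
  -- series is dominated by a geometric one of ratio `c / (2 (c + 1)) < 1`. The added `1` keeps `M`
  -- positive when `c = 0`.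
  set M : ℝ := (2 * (c + 1)) ^ (1 / α) with hM
  have hM0 : 0 < M := by positivity
  have hMα : M ^ α = 2 * (c + 1) := by
    rw [hM, ← Real.rpow_mul (by positivity), one_div_mul_cancel hα.ne', Real.rpow_one]
  have hr : c / (2 * (c + 1)) < 1 := by rw [div_lt_one (by positivity)]; linarith
  refine Summable.of_nonneg_of_le (fun k ↦ ?_) (fun k ↦ ?_)
    ((summable_geometric_of_lt_one (by positivity) hr).mul_left (Real.exp M))
  · have := Real.Gamma_pos_of_pos (show 0 < α * k + 1 by positivity)
    positivity
  · have h1 := rpow_mul_exp_neg_le_Gamma (q := α * k) (by positivity) hM0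
    rw [Real.rpow_mul hM0.le, hMα, Real.rpow_natCast] at h1
    have h2 : 0 < (2 * (c + 1)) ^ k * Real.exp (-M) := by positivity
    refine (div_le_div_of_nonneg_left (by positivity) h2 h1).trans_eq ?_
    rw [Real.exp_neg, div_pow]
    field_simp

/-- Absolute moments of a centred Gaussian variable. -/
theorem lintegral_abs_rpow_gaussianReal (v : ℝ≥0) {m : ℝ} (hm : 0 < m) :
    ∫⁻ x, ENNReal.ofReal (|x| ^ m) ∂gaussianReal 0 v =
      ENNReal.ofReal ((2 * v) ^ (m / 2) * (Real.Gamma ((m + 1) / 2) / √Real.pi)) := by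
  have hG : 0 < Real.Gamma ((m + 1) / 2) := Real.Gamma_pos_of_pos (by positivity)
  rcases eq_or_ne v 0 with rfl | hv
  · simp [gaussianReal_zero_var, Real.zero_rpow hm.ne', Real.zero_rpow (half_pos hm).ne']
  have hv0 : (0 : ℝ) < v := by positivity
  have hint : ∫ x, |x| ^ m ∂gaussianReal 0 v =
      (2 * v) ^ (m / 2) * (Real.Gamma ((m + 1) / 2) / √Real.pi) := by
    rw [integral_gaussianReal_eq_integral_smul hv]
    have h1 : ∀ x : ℝ, gaussianPDFReal 0 v x • |x| ^ m = (√(2 * Real.pi * v))⁻¹ *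
        (fun x : ℝ ↦ x ^ m * Real.exp (-(1 / (2 * v)) * x ^ (2 : ℝ))) |x| := by
      intro x
      simp only [gaussianPDFReal, smul_eq_mul, sub_zero]
      rw [Real.rpow_two, sq_abs, mul_assoc, mul_comm (Real.exp _)]
      congr 3
      ring
    simp_rw [h1]
    rw [integral_const_mul, integral_comp_abs
      (f := fun x : ℝ ↦ x ^ m * Real.exp (-(1 / (2 * v)) * x ^ (2 : ℝ))),
      integral_rpow_mul_exp_neg_mul_rpow two_pos (by linarith) (by positivity),
      one_div, Real.inv_rpow (by positivity), ← Real.rpow_neg (by positivity),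
      show -(-(m + 1) / 2) = m / 2 + 1 / 2 by ring, Real.rpow_add (by positivity),
      ← Real.sqrt_eq_rpow, show 2 * Real.pi * (v : ℝ) = Real.pi * (2 * v) by ring,
      Real.sqrt_mul Real.pi_pos.le]
    have h2 : 0 < √(2 * (v : ℝ)) := Real.sqrt_pos.2 (by positivity)
    have h3 : 0 < √Real.pi := Real.sqrt_pos.2 Real.pi_pos
    field_simp
  rw [← hint, ofReal_integral_eq_lintegral_ofReal]
  · refine not_imp_comm.1 integral_undef ?_
    rw [hint]
    have h3 : 0 < √Real.pi := Real.sqrt_pos.2 Real.pi_pos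
    positivity
  · exact ae_of_all _ fun x ↦ by positivity

/-- Moments are computed as lower integrals, where Tonelli asks for no integrability; a finite
answer then yields integrability and value at once. -/
theorem integral_eq_of_lintegral_ofReal {Ω : Type*} [MeasurableSpace Ω] {P : Measure Ω} {f : Ω → ℝ}
    {c : ℝ} (hf : AEMeasurable f P) (h0 : 0 ≤ᵐ[P] f) (hc : 0 ≤ c)
    (h : ∫⁻ ω, ENNReal.ofReal (f ω) ∂P = ENNReal.ofReal c) : Integrable f P ∧ ∫ ω, f ω ∂P = c := by
  refine ⟨⟨hf.aestronglyMeasurable, ?_⟩, ?_⟩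
  · rw [hasFiniteIntegral_iff_ofReal h0, h]
    exact ENNReal.ofReal_lt_top
  · rw [integral_eq_lintegral_of_nonneg_ae h0 hf.aestronglyMeasurable, h, ENNReal.toReal_ofReal hc]

theorem memLp_of_lintegral_abs_rpow_ne_top {Ω : Type*} [MeasurableSpace Ω] {P : Measure Ω}
    {f : Ω → ℝ} (hf : AEMeasurable f P)
    (h : ∀ m : ℝ, 0 < m → ∫⁻ ω, ENNReal.ofReal (|f ω| ^ m) ∂P ≠ ⊤) (p : ℝ≥0) : MemLp f p P := by
  rcases eq_or_ne p 0 with rfl | hp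
  · rw [ENNReal.coe_zero, memLp_zero_iff_aestronglyMeasurable]
    exact hf.aestronglyMeasurable
  refine ⟨hf.aestronglyMeasurable, ?_⟩
  rw [eLpNorm_lt_top_iff_lintegral_rpow_enorm_lt_top (by simpa using hp) ENNReal.coe_ne_top]
  refine lt_of_eq_of_lt ?_ (h p (by positivity)).lt_top
  refine lintegral_congr fun ω ↦ ?_
  rw [ENNReal.coe_toReal, ← ENNReal.ofReal_rpow_of_nonneg (abs_nonneg _) p.coe_nonneg,
    Real.enorm_eq_ofReal_abs]

/-! ### Moments of increments of the inverse subordinator -/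

section Increments

variable {Ω : Type*} [MeasurableSpace Ω] {P : Measure Ω} [IsProbabilityMeasure P] {α : ℝ}
  {D : ℝ≥0 → Ω → ℝ}

/-- The kernel is a power of `b - u`, not of `u - a`: with `b = Y t` it becomes a power of the
overshoot `Y t - u`, whose moments are known. -/
theorem lintegral_ite_rpow_sub {κ a b : ℝ} (hκ : 0 < κ) (ha : 0 ≤ a) (hab : a ≤ b) :
    ∫⁻ u in Set.Ioi (0 : ℝ), (if a < u ∧ u < b then ENNReal.ofReal (κ * (b - u) ^ (κ - 1)) else 0) =
      ENNReal.ofReal ((b - a) ^ κ) := by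
  have hi : IntervalIntegrable (fun u ↦ κ * (b - u) ^ (κ - 1)) volume a b := by
    have h1 : IntervalIntegrable (fun x : ℝ ↦ x ^ (κ - 1)) volume (b - a) (b - b) :=
      intervalIntegral.intervalIntegrable_rpow' (by linarith)
    have h2 := h1.comp_sub_left b
    simp only [sub_sub_cancel] at h2
    exact h2.const_mul κ
  have hval : ∫ u in a..b, κ * (b - u) ^ (κ - 1) = (b - a) ^ κ := by
    rw [intervalIntegral.integral_const_mul,
      intervalIntegral.integral_comp_sub_left (fun x ↦ x ^ (κ - 1)) b, sub_self,
      integral_rpow (Or.inl (by linarith)), sub_add_cancel, Real.zero_rpow hκ.ne', sub_zero]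
    field_simp
  rw [intervalIntegrable_iff_integrableOn_Ioc_of_le hab,
    integrableOn_Ioc_iff_integrableOn_Ioo] at hi
  rw [← hval, intervalIntegral.integral_of_le hab, integral_Ioc_eq_integral_Ioo,
    ofReal_integral_eq_lintegral_ofReal hi]
  · have : ∀ u : ℝ, (if a < u ∧ u < b then ENNReal.ofReal (κ * (b - u) ^ (κ - 1)) else 0) =
        (Set.Ioo a b).indicator (fun u ↦ ENNReal.ofReal (κ * (b - u) ^ (κ - 1))) u := fun u ↦ by
      simp [Set.indicator_apply]
    simp_rw [this]
    rw [setLIntegral_indicator measurableSet_Ioo,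
      Set.inter_eq_left.2 fun x hx ↦ Set.mem_Ioi.2 (ha.trans_lt hx.1)]
  · filter_upwards [ae_restrict_mem measurableSet_Ioo] with u hu
    have : 0 < b - u := sub_pos.2 hu.2
    simp only [Pi.zero_apply]
    positivity

/-- Integrate the representation of the power over `u`, exchange with the expectation, and turn `Y s
< u < Y t` into `s < D u ≤ t`. The overshoot moment of order `κ - 1` and the potential measure then
leave a Beta integral over `(s, t]`. -/
theorem IsStableSubordinator.lintegral_inverseProcess_sub_rpow (hα : α ∈ Set.Ioo (0 : ℝ) 1)
    (hD : IsStableSubordinator α D P) {s t : ℝ≥0} (ht : 0 < t) (hst : s ≤ t) {κ : ℝ} (hκ : 0 < κ) :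
    ∫⁻ ω, ENNReal.ofReal (|(inverseProcess D t ω : ℝ) - inverseProcess D s ω| ^ κ) ∂P =
      ENNReal.ofReal (κ * inverseMoment α (κ - 1) / Real.Gamma α * ((t : ℝ) ^ (α * κ) *
        (beta α (α * (κ - 1) + 1) - incompleteBeta α (α * (κ - 1) + 1) (s / t)))) := by
  have hm := hD.measurable
  have hα0 := hα.1
  have hα1 := hα.2
  have hb : 0 < α * (κ - 1) + 1 := by nlinarith
  have hG : 0 < Real.Gamma α := Real.Gamma_pos_of_pos hα0
  have hc : 0 ≤ inverseMoment α (κ - 1) :=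
    div_nonneg (Real.Gamma_pos_of_pos (by linarith)).le (Real.Gamma_pos_of_pos (by linarith)).le
  have hYs := (hD.aemeasurable_inverseProcess s).coe_nnreal_real
  have hYt := (hD.aemeasurable_inverseProcess t).coe_nnreal_real
  have h1 : ∫⁻ ω, ENNReal.ofReal (|(inverseProcess D t ω : ℝ) - inverseProcess D s ω| ^ κ) ∂P =
      ∫⁻ ω, (∫⁻ u in Set.Ioi (0 : ℝ),
        (if (inverseProcess D s ω : ℝ) < u ∧ u < inverseProcess D t ω then
          ENNReal.ofReal (κ * ((inverseProcess D t ω : ℝ) - u) ^ (κ - 1)) else 0)) ∂P := by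
    refine lintegral_congr_ae ?_
    filter_upwards [hD.inverseProcess_mono hst] with ω h
    have h' := NNReal.coe_le_coe.2 h
    rw [abs_of_nonneg (sub_nonneg.2 h'), lintegral_ite_rpow_sub hκ (NNReal.coe_nonneg _) h']
  have hmeas : AEMeasurable (Function.uncurry fun (ω : Ω) (u : ℝ) ↦
      (if (inverseProcess D s ω : ℝ) < u ∧ u < inverseProcess D t ω then
        ENNReal.ofReal (κ * ((inverseProcess D t ω : ℝ) - u) ^ (κ - 1)) else 0))
      (P.prod (volume.restrict (Set.Ioi (0 : ℝ)))) := by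
    have hF : Measurable fun p : ℝ × ℝ × ℝ ↦ (if p.1 < p.2.2 ∧ p.2.2 < p.2.1 then
        ENNReal.ofReal (κ * (p.2.1 - p.2.2) ^ (κ - 1)) else 0) := by
      refine Measurable.ite ?_ (by fun_prop) measurable_const
      exact (measurableSet_lt measurable_fst measurable_snd.snd).inter
        (measurableSet_lt measurable_snd.snd measurable_snd.fst)
    exact hF.comp_aemeasurable (hYs.comp_fst.prodMk (hYt.comp_fst.prodMk measurable_snd.aemeasurable))
  -- A law has at most countably many atoms, so for almost every `u` neither inverse equals `u` with
  -- positive probability.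
  have hnull : ∀ᵐ u : ℝ, P {ω | (inverseProcess D s ω : ℝ) = u} = 0 ∧
      P {ω | (inverseProcess D t ω : ℝ) = u} = 0 := by
    have key : ∀ r : ℝ≥0, ∀ᵐ u : ℝ, P {ω | (inverseProcess D r ω : ℝ) = u} = 0 := by
      intro r
      have := Measure.countable_meas_level_set_pos₀ (μ := P)
        (hD.aemeasurable_inverseProcess r).coe_nnreal_real.nullMeasurable
      filter_upwards [this.ae_notMem volume] with u hu
      simpa using hu
    filter_upwards [key s, key t] with u h1 h2 using ⟨h1, h2⟩
  set g : ℝ → ℝ≥0∞ := (Set.Ioc (s : ℝ) t).indicator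
    fun y ↦ ENNReal.ofReal ((t - y) ^ (α * (κ - 1))) with hg
  have hgm : Measurable g := Measurable.indicator (by fun_prop) measurableSet_Ioc
  have h2 : ∫⁻ u in Set.Ioi (0 : ℝ), (∫⁻ ω,
        (if (inverseProcess D s ω : ℝ) < u ∧ u < inverseProcess D t ω then
          ENNReal.ofReal (κ * ((inverseProcess D t ω : ℝ) - u) ^ (κ - 1)) else 0) ∂P) =
      ∫⁻ u in Set.Ioi (0 : ℝ), ENNReal.ofReal (κ * inverseMoment α (κ - 1)) *
        (∫⁻ ω, g (D u.toNNReal ω) ∂P) := by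
    refine lintegral_congr_ae ?_
    filter_upwards [ae_restrict_mem measurableSet_Ioi, ae_restrict_of_ae hnull] with u hu hu0
    have hu' : (0 : ℝ) < u := hu
    lift u to ℝ≥0 using hu'.le
    have e1 : ∫⁻ ω, g (D u ω) ∂P =
        ∫⁻ ω in D u ⁻¹' Set.Ioc (s : ℝ) t, ENNReal.ofReal ((t - D u ω) ^ (α * (κ - 1))) ∂P := by
      rw [← lintegral_indicator (hm u measurableSet_Ioc)]
      rfl
    rw [Real.toNNReal_coe, e1, ENNReal.ofReal_mul hκ.le, mul_assoc,
      ← hD.setLIntegral_rpow_sub hα u t s (by linarith), ← lintegral_const_mul' _ _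
        ENNReal.ofReal_ne_top, ← lintegral_indicator (hm u measurableSet_Ioc)]
    refine lintegral_congr_ae ?_
    have hs0 : ∀ᵐ ω ∂P, (inverseProcess D s ω : ℝ) ≠ u := by
      rw [ae_iff]; simpa using hu0.1
    have ht0 : ∀ᵐ ω ∂P, (inverseProcess D t ω : ℝ) ≠ u := by
      rw [ae_iff]; simpa using hu0.2
    filter_upwards [hs0, ht0, hD.ae_sandwich s, hD.ae_sandwich t] with ω n1 n2 a1 a2
    -- Off the two atoms the weak and strict halves of the sandwich agree, so both events coincide.
    have hiff : ((inverseProcess D s ω : ℝ) < u ∧ (u : ℝ) < inverseProcess D t ω) ↔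
        ω ∈ D u ⁻¹' Set.Ioc (s : ℝ) t := by
      constructor
      · rintro ⟨b1, b2⟩
        refine ⟨not_le.1 fun hc ↦ ?_, le_of_lt_inverseProcess (NNReal.coe_lt_coe.1 b2)⟩
        exact absurd (NNReal.coe_le_coe.2 (a1 u hc)) (not_le.2 b1)
      · rintro ⟨b1, b2⟩
        refine ⟨lt_of_le_of_ne (not_lt.1 fun hc ↦ ?_) n1,
          lt_of_le_of_ne (NNReal.coe_le_coe.2 (a2 u b2)) (Ne.symm n2)⟩
        exact absurd (le_of_lt_inverseProcess (NNReal.coe_lt_coe.1 hc)) (not_le.2 b1)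
    by_cases hω : ω ∈ D u ⁻¹' Set.Ioc (s : ℝ) t
    · rw [Set.indicator_of_mem hω, if_pos (hiff.2 hω), ENNReal.ofReal_mul hκ.le]
    · rw [Set.indicator_of_notMem hω, if_neg (mt hiff.1 hω)]
  rw [h1, lintegral_lintegral_swap hmeas, h2, lintegral_const_mul' _ _ ENNReal.ofReal_ne_top,
    hD.lintegral_potential hα hgm]
  have h3 : ∫⁻ y in Set.Ioi (0 : ℝ), ENNReal.ofReal (y ^ (α - 1) / Real.Gamma α) * g y =
      ENNReal.ofReal (1 / Real.Gamma α) * ∫⁻ y in Set.Ioc (s : ℝ) t,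
        ENNReal.ofReal ((t - y) ^ (α * (κ - 1) + 1 - 1) * y ^ (α - 1)) := by
    have : ∀ y : ℝ, ENNReal.ofReal (y ^ (α - 1) / Real.Gamma α) * g y =
        (Set.Ioc (s : ℝ) t).indicator (fun y ↦ ENNReal.ofReal (1 / Real.Gamma α) *
          ENNReal.ofReal ((t - y) ^ (α * (κ - 1) + 1 - 1) * y ^ (α - 1))) y := by
      intro y
      by_cases hy : y ∈ Set.Ioc (s : ℝ) t
      · have hy1 : 0 ≤ (t : ℝ) - y := sub_nonneg.2 hy.2
        have hy0 : 0 ≤ y := s.coe_nonneg.trans hy.1.le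
        rw [hg, Set.indicator_of_mem hy, Set.indicator_of_mem hy,
          ← ENNReal.ofReal_mul (by positivity), ← ENNReal.ofReal_mul (by positivity),
          add_sub_cancel_right]
        congr 1
        ring
      · rw [hg, Set.indicator_of_notMem hy, Set.indicator_of_notMem hy, mul_zero]
    simp_rw [this]
    rw [setLIntegral_indicator measurableSet_Ioc,
      Set.inter_eq_left.2 fun x hx ↦ Set.mem_Ioi.2 (s.coe_nonneg.trans_lt hx.1),
      lintegral_const_mul' _ _ ENNReal.ofReal_ne_top]
  rw [h3, setLIntegral_beta hα0 hb (by exact_mod_cast ht) s.coe_nonneg (by exact_mod_cast hst),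
    ← ENNReal.ofReal_mul (by positivity), ← ENNReal.ofReal_mul (by positivity)]
  congr 1
  rw [show α + (α * (κ - 1) + 1) - 1 = α * κ by ring]
  ring

/-- The absolute moments of the increments of the inverse stable subordinator. -/
theorem IsStableSubordinator.integral_abs_inverseProcess_sub_rpow (hα : α ∈ Set.Ioo (0 : ℝ) 1)
    (hD : IsStableSubordinator α D P) {s t : ℝ≥0} (ht : 0 < t) (hst : s ≤ t) {κ : ℝ} (hκ : 0 < κ) :
    Integrable (fun ω ↦ |(inverseProcess D t ω : ℝ) - inverseProcess D s ω| ^ κ) P ∧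
    ∫ ω, |(inverseProcess D t ω : ℝ) - inverseProcess D s ω| ^ κ ∂P =
      Real.Gamma (κ + 1) * (t : ℝ) ^ (α * κ) / Real.Gamma (α * κ + 1) -
        Real.Gamma (κ + 1) * (t : ℝ) ^ (α * κ) /
          (Real.Gamma α * Real.Gamma (α * (κ - 1) + 1)) *
          incompleteBeta α (α * (κ - 1) + 1) (s / t) := by
  have hα0 := hα.1
  have hα1 := hα.2
  have ht' : (0 : ℝ) < t := ht
  have hst' : (s : ℝ) ≤ t := hst
  have hb : 0 < α * (κ - 1) + 1 := by nlinarith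
  have hG : 0 < Real.Gamma α := Real.Gamma_pos_of_pos hα0
  have hGb : 0 < Real.Gamma (α * (κ - 1) + 1) := Real.Gamma_pos_of_pos hb
  have hGk : 0 < Real.Gamma (α * κ + 1) := Real.Gamma_pos_of_pos (by positivity)
  have hGκ : 0 < Real.Gamma κ := Real.Gamma_pos_of_pos hκ
  -- Needed to remove `ENNReal.ofReal`: the difference is the integral of a nonnegative function
  -- over `[s/t, 1]`.
  have hdiff : 0 ≤ beta α (α * (κ - 1) + 1) - incompleteBeta α (α * (κ - 1) + 1) (s / t) := by
    have hz : (s : ℝ) / t ∈ Set.Icc (0 : ℝ) 1 := ⟨by positivity, (div_le_one ht').2 hst'⟩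
    rw [← incompleteBeta_one hα0 hb, incompleteBeta, incompleteBeta,
      intervalIntegral.integral_interval_sub_left]
    · refine intervalIntegral.integral_nonneg hz.2 fun u hu ↦ ?_
      have h1 : 0 ≤ 1 - u := sub_nonneg.2 hu.2
      have h2 := hz.1.trans hu.1
      positivity
    · exact intervalIntegrable_incompleteBeta hα0 hb ⟨le_rfl, zero_le_one⟩ ⟨zero_le_one, le_rfl⟩
    · exact intervalIntegrable_incompleteBeta hα0 hb ⟨le_rfl, zero_le_one⟩ hz
  have hc : 0 ≤ inverseMoment α (κ - 1) :=
    div_nonneg (Real.Gamma_pos_of_pos (by linarith)).le (Real.Gamma_pos_of_pos (by linarith)).le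
  have h := integral_eq_of_lintegral_ofReal
    (((hD.aemeasurable_inverseProcess t).coe_nnreal_real.sub
      (hD.aemeasurable_inverseProcess s).coe_nnreal_real).abs.pow_const κ)
    (ae_of_all _ fun ω ↦ by simp only [Pi.zero_apply]; positivity)
    (mul_nonneg (by positivity) (mul_nonneg (by positivity) hdiff))
    (hD.lintegral_inverseProcess_sub_rpow hα ht hst hκ)
  refine ⟨h.1, h.2.trans ?_⟩
  rw [inverseMoment, beta, add_sub_cancel, add_comm 1 (α * (κ - 1)),
    show α + (α * (κ - 1) + 1) = α * κ + 1 by ring, Real.Gamma_add_one hκ.ne']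
  field_simp

end Increments

/-! ### Freezing an independent variable -/

section Indep

variable {Ω E F : Type*} [MeasurableSpace Ω] [MeasurableSpace E] [MeasurableSpace F] {P : Measure Ω}
  [IsProbabilityMeasure P] {X : Ω → E} {T : Ω → F}

theorem lintegral_comp_of_indepFun (hX : Measurable X) (hT : AEMeasurable T P)
    (h : IndepFun X T P) {Φ : E × F → ℝ≥0∞} (hΦ : Measurable Φ) :
    ∫⁻ ω, Φ (X ω, T ω) ∂P = ∫⁻ ω, (∫⁻ ω', Φ (X ω', T ω) ∂P) ∂P := by
  have hlaw := (indepFun_iff_map_prod_eq_prod_map_map hX.aemeasurable hT).1 h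
  rw [← lintegral_map' hΦ.aemeasurable (hX.aemeasurable.prodMk hT), hlaw,
    lintegral_prod_symm _ hΦ.aemeasurable,
    lintegral_map' (Measurable.lintegral_prod_left' hΦ).aemeasurable hT]
  refine lintegral_congr fun ω ↦ ?_
  exact lintegral_map (hΦ.comp measurable_prodMk_right) hX

theorem integral_comp_eq_zero_of_indepFun (hX : Measurable X) (hT : AEMeasurable T P)
    (h : IndepFun X T P) {Φ : E × F → ℝ} (hΦ : Measurable Φ)
    (hi : Integrable (fun ω ↦ Φ (X ω, T ω)) P) (h0 : ∀ y, ∫ ω, Φ (X ω, y) ∂P = 0) :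
    ∫ ω, Φ (X ω, T ω) ∂P = 0 := by
  have hlaw := (indepFun_iff_map_prod_eq_prod_map_map hX.aemeasurable hT).1 h
  have hj := hX.aemeasurable.prodMk hT
  have hi' : Integrable Φ ((P.map X).prod (P.map T)) := by
    rw [← hlaw, integrable_map_measure hΦ.aestronglyMeasurable hj]
    exact hi
  rw [← integral_map hj hΦ.aestronglyMeasurable, hlaw, integral_prod_symm _ hi']
  have hin : ∀ y, ∫ x, Φ (x, y) ∂P.map X = 0 := fun y ↦
    (integral_map hX.aemeasurable (hΦ.comp measurable_prodMk_right).aestronglyMeasurable).trans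
      (h0 y)
  simp [hin]

end Indep

/-! ### Fractional Brownian motion at an independent random time -/

section Subordination

/-- Evaluation of a path, made jointly measurable by passing through the values on a countable
set; for a continuous path it is the usual evaluation. -/
noncomputable def pathEval (b : ℝ≥0 → ℝ) (u : ℝ≥0) : ℝ :=
  limsup (fun n : ℕ ↦ b (Real.toNNReal (⌊(u : ℝ) * n⌋₊ / (n : ℝ)))) atTop

theorem pathEval_eq {b : ℝ≥0 → ℝ} (hb : Continuous b) (u : ℝ≥0) : pathEval b u = b u := by
  refine Tendsto.limsup_eq ?_
  have h1 : Tendsto (fun n : ℕ ↦ (⌊(u : ℝ) * n⌋₊ : ℝ) / (n : ℝ)) atTop (𝓝 u) :=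
    (tendsto_nat_floor_mul_div_atTop u.coe_nonneg).comp tendsto_natCast_atTop_atTop
  have h2 := (continuous_real_toNNReal.tendsto (u : ℝ)).comp h1
  rw [Real.toNNReal_coe] at h2
  exact (hb.tendsto u).comp h2

/-- At stage `n` only the coordinates `k / n` are read, and evaluation is jointly measurable in the
path and a discrete index `k`. Direct evaluation is not jointly measurable on the full product space
of paths. -/
theorem measurable_pathEval : Measurable fun p : (ℝ≥0 → ℝ) × ℝ≥0 ↦ pathEval p.1 p.2 := by
  refine Measurable.limsup fun n ↦ ?_
  have h1 : Measurable fun p : (ℝ≥0 → ℝ) × ℕ ↦ p.1 (Real.toNNReal (p.2 / (n : ℝ))) :=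
    measurable_from_prod_countable_left fun k ↦
      measurable_pi_apply (Real.toNNReal (k / (n : ℝ)))
  have h2 : Measurable fun p : (ℝ≥0 → ℝ) × ℝ≥0 ↦ (p.1, ⌊(p.2 : ℝ) * n⌋₊) := by
    refine measurable_fst.prodMk (Nat.measurable_floor.comp ?_)
    exact measurable_snd.coe_nnreal_real.mul_const _
  exact h1.comp h2

theorem measurable_pathEval_comp {E : Type*} [MeasurableSpace E] {f : E → ℝ≥0 → ℝ} {g : E → ℝ≥0}
    (hf : Measurable f) (hg : Measurable g) : Measurable fun x ↦ pathEval (f x) (g x) :=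
  Measurable.comp (g := fun p : (ℝ≥0 → ℝ) × ℝ≥0 ↦ pathEval p.1 p.2) (f := fun x ↦ (f x, g x))
    measurable_pathEval (hf.prodMk hg)

variable {Ω : Type*} [MeasurableSpace Ω] {P : Measure Ω} [IsProbabilityMeasure P] {H σ : ℝ}
  {B : ℝ≥0 → Ω → ℝ} {Y : ℝ≥0 → Ω → ℝ≥0}

omit [IsProbabilityMeasure P] in
theorem IsFractionalBrownianMotion.ae_pathEval_eq (hB : IsFractionalBrownianMotion H σ B P) :
    ∀ᵐ ω ∂P, ∀ u, pathEval (fun t ↦ B t ω) u = B u ω := by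
  filter_upwards [hB.continuous] with ω h u using pathEval_eq h u

omit [IsProbabilityMeasure P] in
theorem IsFractionalBrownianMotion.aemeasurable_comp (hB : IsFractionalBrownianMotion H σ B P)
    {τ : Ω → ℝ≥0} (hτ : AEMeasurable τ P) : AEMeasurable (fun ω ↦ B (τ ω) ω) P := by
  have hm : Measurable fun ω t ↦ B t ω := measurable_pi_lambda _ hB.measurable
  refine (measurable_pathEval.comp_aemeasurable (hm.aemeasurable.prodMk hτ)).congr ?_
  filter_upwards [hB.ae_pathEval_eq] with ω h using h _

/-- Conditioning on the time change. -/
theorem IsFractionalBrownianMotion.lintegral_comp (hB : IsFractionalBrownianMotion H σ B P)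
    (hBY : IndepFun (fun ω t ↦ B t ω) (fun ω t ↦ Y t ω) P)
    (hY : ∀ t, AEMeasurable (Y t) P) (s t : ℝ≥0) {φ : ℝ → ℝ≥0∞} (hφ : Measurable φ) :
    ∫⁻ ω, φ (B (Y t ω) ω - B (Y s ω) ω) ∂P =
      ∫⁻ ω, (∫⁻ ω', φ (B (Y t ω) ω' - B (Y s ω) ω') ∂P) ∂P := by
  have hm : Measurable fun ω t ↦ B t ω := measurable_pi_lambda _ hB.measurable
  have hYY := (hY t).prodMk (hY s)
  have hind := hBY.comp measurable_id ((measurable_pi_apply t).prodMk (measurable_pi_apply s))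
  have hΦ : Measurable fun p : (ℝ≥0 → ℝ) × (ℝ≥0 × ℝ≥0) ↦
      φ (pathEval p.1 p.2.1 - pathEval p.1 p.2.2) := by
    refine hφ.comp (Measurable.sub ?_ ?_)
    · exact measurable_pathEval_comp measurable_fst measurable_snd.fst
    · exact measurable_pathEval_comp measurable_fst measurable_snd.snd
  refine Eq.trans (lintegral_congr_ae ?_) ((lintegral_comp_of_indepFun hm hYY hind hΦ).trans
    (lintegral_congr fun ω ↦ lintegral_congr_ae ?_))
  · filter_upwards [hB.ae_pathEval_eq] with ω h
    simp only [h]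
  · filter_upwards [hB.ae_pathEval_eq] with ω' h
    simp only [h]

theorem IsFractionalBrownianMotion.integral_comp (hB : IsFractionalBrownianMotion H σ B P)
    (hBY : IndepFun (fun ω t ↦ B t ω) (fun ω t ↦ Y t ω) P)
    (hY : ∀ t, AEMeasurable (Y t) P) (t : ℝ≥0) (hi : Integrable (fun ω ↦ B (Y t ω) ω) P) :
    ∫ ω, B (Y t ω) ω ∂P = 0 := by
  have hm : Measurable fun ω t ↦ B t ω := measurable_pi_lambda _ hB.measurable
  have hind := hBY.comp measurable_id (measurable_pi_apply t)
  have heq : (fun ω ↦ B (Y t ω) ω) =ᵐ[P] fun ω ↦ pathEval (fun r ↦ B r ω) (Y t ω) := by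
    filter_upwards [hB.ae_pathEval_eq] with ω h
    rw [h]
  rw [integral_congr_ae heq]
  refine integral_comp_eq_zero_of_indepFun hm (hY t) hind measurable_pathEval (hi.congr heq)
    fun u ↦ ?_
  rw [← hB.mean_zero u]
  refine integral_congr_ae ?_
  filter_upwards [hB.ae_pathEval_eq] with ω h
  simp only [h]

/-- The increments of fractional Brownian motion are centred Gaussian. -/
theorem IsFractionalBrownianMotion.map_sub (hB : IsFractionalBrownianMotion H σ B P) (hH : 0 < H)
    (u v : ℝ≥0) : P.map (fun ω ↦ B u ω - B v ω) =
      gaussianReal 0 (Real.toNNReal (σ ^ 2 * |(u : ℝ) - v| ^ (2 * H))) := by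
  have hg := hB.gaussian.hasGaussianLaw_fun_sub (s := u) (t := v)
  have hL : ∀ r, MemLp (B r) 2 P := fun r ↦ (hB.gaussian.hasGaussianLaw_eval r).memLp_two
  have hI : ∀ r q, Integrable (fun ω ↦ B r ω * B q ω) P := fun r q ↦ (hL r).integrable_mul (hL q)
  have hmean : ∫ ω, (B u ω - B v ω) ∂P = 0 := by
    rw [integral_sub ((hL u).integrable one_le_two) ((hL v).integrable one_le_two),
      hB.mean_zero, hB.mean_zero, sub_zero]
  -- Here `H > 0` matters, through `0 ^ (2 * H) = 0`.
  have hself : ∀ r : ℝ≥0, ∫ ω, B r ω * B r ω ∂P = σ ^ 2 * (r : ℝ) ^ (2 * H) := by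
    intro r
    rw [hB.covariance, sub_self, abs_zero, Real.zero_rpow (by positivity)]
    ring
  have hvar : variance (fun ω ↦ B u ω - B v ω) P = σ ^ 2 * |(u : ℝ) - v| ^ (2 * H) := by
    rw [variance_of_integral_eq_zero (hg.aemeasurable) hmean]
    have : ∀ ω, (B u ω - B v ω) ^ 2 = B u ω * B u ω - 2 * (B u ω * B v ω) + B v ω * B v ω :=
      fun ω ↦ by ring
    simp_rw [this]
    have h2 : Integrable (fun ω ↦ B u ω * B u ω - 2 * (B u ω * B v ω)) P :=
      (hI u u).sub ((hI u v).const_mul 2)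
    rw [integral_add h2 (hI v v), integral_sub (hI u u) ((hI u v).const_mul 2),
      integral_const_mul, hself, hself, hB.covariance v u]
    ring
  rw [hg.map_eq_gaussianReal, hmean, hvar]

/-- The absolute moments of the increments of time-changed fractional Brownian motion. -/
theorem IsFractionalBrownianMotion.lintegral_abs_rpow_comp (hB : IsFractionalBrownianMotion H σ B P)
    (hH : 0 < H) (hBY : IndepFun (fun ω t ↦ B t ω) (fun ω t ↦ Y t ω) P)
    (hY : ∀ t, AEMeasurable (Y t) P) (s t : ℝ≥0) {m : ℝ} (hm : 0 < m) :
    ∫⁻ ω, ENNReal.ofReal (|B (Y t ω) ω - B (Y s ω) ω| ^ m) ∂P =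
      ENNReal.ofReal ((2 * σ ^ 2) ^ (m / 2) * (Real.Gamma ((m + 1) / 2) / √Real.pi)) *
        ∫⁻ ω, ENNReal.ofReal (|(Y t ω : ℝ) - Y s ω| ^ (m * H)) ∂P := by
  have hG : 0 < Real.Gamma ((m + 1) / 2) := Real.Gamma_pos_of_pos (by positivity)
  have hms := hB.measurable
  -- With the times frozen the increment is Gaussian of variance `σ² |Y t - Y s| ^ (2H)`, and the
  -- power `m / 2` of the variance produces the exponent `mH`.
  rw [hB.lintegral_comp hBY hY s t (φ := fun x ↦ ENNReal.ofReal (|x| ^ m)) (by fun_prop),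
    ← lintegral_const_mul' _ _ ENNReal.ofReal_ne_top]
  refine lintegral_congr fun ω ↦ ?_
  have hd : Measurable fun ω' ↦ B (Y t ω) ω' - B (Y s ω) ω' := (hms (Y t ω)).sub (hms (Y s ω))
  rw [← lintegral_map (f := fun x : ℝ ↦ ENNReal.ofReal (|x| ^ m)) (by fun_prop) hd, hB.map_sub hH, lintegral_abs_rpow_gaussianReal _ hm,
    ← ENNReal.ofReal_mul (by positivity), Real.coe_toNNReal _ (by positivity), ← mul_assoc 2,
    Real.mul_rpow (by positivity) (by positivity), ← Real.rpow_mul (abs_nonneg _)]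
  congr 1
  rw [show 2 * H * (m / 2) = m * H by ring]
  ring

end Subordination

/-! ### Moments and covariances of `Y` and `Z` -/

section Moments

variable {Ω : Type*} [MeasurableSpace Ω] {P : Measure Ω} [IsProbabilityMeasure P] {α : ℝ}
  {D : ℝ≥0 → Ω → ℝ}

theorem IsStableSubordinator.integral_inverseProcess_rpow (hα : α ∈ Set.Ioo (0 : ℝ) 1)
    (hD : IsStableSubordinator α D P) (t : ℝ≥0) {γ : ℝ} (hγ : 0 ≤ γ) :
    Integrable (fun ω ↦ (inverseProcess D t ω : ℝ) ^ γ) P ∧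
    ∫ ω, (inverseProcess D t ω : ℝ) ^ γ ∂P =
      Real.Gamma (γ + 1) * (t : ℝ) ^ (α * γ) / Real.Gamma (α * γ + 1) := by
  have hα0 := hα.1
  have h1 : 0 < Real.Gamma (1 + γ) := Real.Gamma_pos_of_pos (by positivity)
  have h2 : 0 < Real.Gamma (1 + α * γ) := Real.Gamma_pos_of_pos (by positivity)
  have h := integral_eq_of_lintegral_ofReal
    ((hD.aemeasurable_inverseProcess t).coe_nnreal_real.pow_const γ)
    (ae_of_all _ fun ω ↦ by simp only [Pi.zero_apply]; positivity)
    (by unfold inverseMoment; positivity)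
    (hD.lintegral_inverseProcess_rpow hα t (γ := γ) (by linarith))
  refine ⟨h.1, h.2.trans ?_⟩
  rw [inverseMoment, add_comm γ, add_comm (α * γ)]
  ring

theorem IsStableSubordinator.memLp_inverseProcess (hα : α ∈ Set.Ioo (0 : ℝ) 1)
    (hD : IsStableSubordinator α D P) (t p : ℝ≥0) :
    MemLp (fun ω ↦ (inverseProcess D t ω : ℝ)) p P := by
  refine memLp_of_lintegral_abs_rpow_ne_top
    (hD.aemeasurable_inverseProcess t).coe_nnreal_real (fun m hm ↦ ?_) p
  simp_rw [NNReal.abs_eq]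
  rw [hD.lintegral_inverseProcess_rpow hα t (by linarith)]
  exact ENNReal.ofReal_ne_top

/-- Expand the exponential and integrate termwise: the `k!` in the `k`-th moment of `Y t` cancels
the one in the series. The same cancellation turns the norms into a convergent Mittag-Leffler
series, which justifies the exchange. -/
theorem IsStableSubordinator.hasSum_mittagLeffler (hα : α ∈ Set.Ioo (0 : ℝ) 1)
    (hD : IsStableSubordinator α D P) (t : ℝ≥0) {x : ℝ} (hx : 0 ≤ x) :
    HasSum (fun k : ℕ ↦ (-(x * (t : ℝ) ^ α)) ^ k / Real.Gamma (α * k + 1))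
      (∫ ω, Real.exp (-(x * inverseProcess D t ω)) ∂P) := by
  have hα0 := hα.1
  have hpow : ∀ k : ℕ, Integrable (fun ω ↦ (inverseProcess D t ω : ℝ) ^ k) P ∧
      ∫ ω, (inverseProcess D t ω : ℝ) ^ k ∂P =
        k.factorial * ((t : ℝ) ^ α) ^ k / Real.Gamma (α * k + 1) := by
    intro k
    have h := hD.integral_inverseProcess_rpow hα t (γ := k) k.cast_nonneg
    simp only [Real.rpow_natCast, Real.Gamma_nat_eq_factorial] at h
    rwa [Real.rpow_mul t.coe_nonneg, Real.rpow_natCast] at h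
  set F : ℕ → Ω → ℝ := fun k ω ↦ (-x) ^ k / k.factorial * (inverseProcess D t ω : ℝ) ^ k with hF
  have hFi : ∀ k, Integrable (F k) P := fun k ↦ (hpow k).1.const_mul _
  have hFv : ∀ k, ∫ ω, F k ω ∂P = (-(x * (t : ℝ) ^ α)) ^ k / Real.Gamma (α * k + 1) := by
    intro k
    have : (k.factorial : ℝ) ≠ 0 := by positivity
    rw [hF, integral_const_mul, (hpow k).2, ← neg_mul, mul_pow]
    field_simp
  have hFn : ∀ k, ∫ ω, ‖F k ω‖ ∂P = (x * (t : ℝ) ^ α) ^ k / Real.Gamma (α * k + 1) := by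
    intro k
    have hk : (k.factorial : ℝ) ≠ 0 := by positivity
    have : ∀ ω, ‖F k ω‖ = x ^ k / k.factorial * (inverseProcess D t ω : ℝ) ^ k := by
      intro ω
      rw [hF]
      simp [abs_of_nonneg hx]
    simp_rw [this]
    rw [integral_const_mul, (hpow k).2, mul_pow]
    field_simp
  have h := hasSum_integral_of_summable_integral_norm hFi
    (by simp_rw [hFn]; exact summable_pow_div_Gamma hα0 (by positivity))
  simp_rw [hFv] at h
  convert! h using 1
  refine integral_congr_ae (ae_of_all _ fun ω ↦ ?_)
  simp only [hF]
  rw [Real.exp_eq_exp_ℝ, NormedSpace.exp_eq_tsum_div]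
  refine tsum_congr fun k ↦ ?_
  rw [← neg_mul, mul_pow]
  ring

theorem IsStableSubordinator.inverseProcess_zero (hα : α ∈ Set.Ioo (0 : ℝ) 1)
    (hD : IsStableSubordinator α D P) : ∀ᵐ ω ∂P, inverseProcess D 0 ω = 0 := by
  have h := hD.integral_inverseProcess_rpow hα 0 (γ := 1) zero_le_one
  simp only [Real.rpow_one, mul_one, NNReal.coe_zero, Real.zero_rpow hα.1.ne', mul_zero,
    zero_div] at h
  have := (integral_eq_zero_iff_of_nonneg (fun ω ↦ NNReal.coe_nonneg _) h.1).1 h.2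
  filter_upwards [this] with ω hω
  simpa using hω

/-- Polarisation with the increment moment of order `κ = 2`; the second moment of `Y t` cancels the
leading term of the increment moment. -/
theorem IsStableSubordinator.integral_inverseProcess_mul (hα : α ∈ Set.Ioo (0 : ℝ) 1)
    (hD : IsStableSubordinator α D P) {s t : ℝ≥0} (ht : 0 < t) (hst : s ≤ t) :
    ∫ ω, (inverseProcess D t ω : ℝ) * inverseProcess D s ω ∂P =
      (s : ℝ) ^ (2 * α) / Real.Gamma (2 * α + 1) +
        (t : ℝ) ^ (2 * α) / (Real.Gamma α * Real.Gamma (α + 1)) *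
          incompleteBeta α (α + 1) (s / t) := by
  have h := hD.integral_abs_inverseProcess_sub_rpow hα ht hst two_pos
  have ht2 := hD.integral_inverseProcess_rpow hα t (γ := 2) zero_le_two
  have hs2 := hD.integral_inverseProcess_rpow hα s (γ := 2) zero_le_two
  simp only [Real.rpow_two, sq_abs] at h ht2 hs2
  have heq : ∀ ω, (inverseProcess D t ω : ℝ) * inverseProcess D s ω =
      1 / 2 * (((inverseProcess D t ω : ℝ) ^ 2 + (inverseProcess D s ω : ℝ) ^ 2) -
        ((inverseProcess D t ω : ℝ) - inverseProcess D s ω) ^ 2) := fun ω ↦ by ring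
  have hG3 : Real.Gamma (2 + 1) = 2 := by
    rw [Real.Gamma_add_one two_ne_zero, Real.Gamma_two, mul_one]
  simp_rw [heq]
  have h12 : Integrable (fun ω ↦ (inverseProcess D t ω : ℝ) ^ 2 +
    (inverseProcess D s ω : ℝ) ^ 2) P := ht2.1.add hs2.1
  rw [integral_const_mul, integral_sub h12 h.1, integral_add ht2.1 hs2.1, ht2.2, hs2.2,
    h.2, hG3, mul_comm α 2, show α * (2 - 1) + 1 = α + 1 by ring]
  ring

variable {H σ : ℝ} {B : ℝ≥0 → Ω → ℝ}

/-- Time-changed fractional Brownian motion. -/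
noncomputable def timeChange (B D : ℝ≥0 → Ω → ℝ) (t : ℝ≥0) (ω : Ω) : ℝ := B (inverseProcess D t ω) ω

theorem aemeasurable_timeChange (hD : IsStableSubordinator α D P)
    (hB : IsFractionalBrownianMotion H σ B P) (t : ℝ≥0) : AEMeasurable (timeChange B D t) P :=
  hB.aemeasurable_comp (hD.aemeasurable_inverseProcess t)

/-- The covariance formula forces `E[B(0)²] = 0`, and the first moment of `Y 0` vanishes, so both `B
0` and `Y 0` are almost surely `0`. -/
theorem timeChange_zero (hα : α ∈ Set.Ioo (0 : ℝ) 1) (hH : 0 < H) (hD : IsStableSubordinator α D P)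
    (hB : IsFractionalBrownianMotion H σ B P) : ∀ᵐ ω ∂P, timeChange B D 0 ω = 0 := by
  have h0 := hB.covariance 0 0
  simp only [NNReal.coe_zero, Real.zero_rpow (show 2 * H ≠ 0 by positivity), sub_self, abs_zero,
    add_zero, mul_zero] at h0
  have hL : MemLp (B 0) 2 P := (hB.gaussian.hasGaussianLaw_eval 0).memLp_two
  have := (integral_eq_zero_iff_of_nonneg (fun ω ↦ mul_self_nonneg _) (hL.integrable_mul hL)).1 h0
  filter_upwards [this, hD.inverseProcess_zero hα] with ω h1 h2
  rw [timeChange, h2]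
  simpa using h1

theorem integral_abs_timeChange_sub_rpow (hα : α ∈ Set.Ioo (0 : ℝ) 1) (hH : 0 < H)
    (hD : IsStableSubordinator α D P) (hB : IsFractionalBrownianMotion H σ B P)
    (hBY : IndepFun (fun ω t ↦ B t ω) (fun ω t ↦ inverseProcess D t ω) P)
    {s t : ℝ≥0} (hst : s ≤ t) {m : ℝ} (hm : 0 < m) :
    Integrable (fun ω ↦ |timeChange B D t ω - timeChange B D s ω| ^ m) P ∧
    ∫ ω, |timeChange B D t ω - timeChange B D s ω| ^ m ∂P =
      (2 * σ ^ 2) ^ (m / 2) * (Real.Gamma ((m + 1) / 2) / √Real.pi) *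
        ∫ ω, |(inverseProcess D t ω : ℝ) - inverseProcess D s ω| ^ (m * H) ∂P := by
  have hG : 0 < Real.Gamma ((m + 1) / 2) := Real.Gamma_pos_of_pos (by positivity)
  have hmH : 0 < m * H := by positivity
  have hYi : Integrable (fun ω ↦ |(inverseProcess D t ω : ℝ) - inverseProcess D s ω| ^ (m * H)) P := by
    -- The increment formula divides by `t`; for `t = 0` both times are `0` and the increment is
    -- identically zero.
    rcases eq_or_ne t 0 with rfl | ht
    · obtain rfl : s = 0 := le_antisymm hst zero_le
      simp [Real.zero_rpow hmH.ne']
    · exact (hD.integral_abs_inverseProcess_sub_rpow hα (pos_of_ne_zero ht) hst hmH).1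
  have h0 : 0 ≤ ∫ ω, |(inverseProcess D t ω : ℝ) - inverseProcess D s ω| ^ (m * H) ∂P :=
    integral_nonneg fun ω ↦ by positivity
  refine integral_eq_of_lintegral_ofReal
    (((aemeasurable_timeChange hD hB t).sub (aemeasurable_timeChange hD hB s)).abs.pow_const m)
    (ae_of_all _ fun ω ↦ by simp only [Pi.zero_apply]; positivity) (by positivity) ?_
  rw [ENNReal.ofReal_mul (by positivity), ofReal_integral_eq_lintegral_ofReal hYi
    (ae_of_all _ fun ω ↦ by simp only [Pi.zero_apply]; positivity)]
  exact hB.lintegral_abs_rpow_comp hH hBY hD.aemeasurable_inverseProcess s t hm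

theorem memLp_timeChange (hα : α ∈ Set.Ioo (0 : ℝ) 1) (hH : 0 < H)
    (hD : IsStableSubordinator α D P) (hB : IsFractionalBrownianMotion H σ B P)
    (hBY : IndepFun (fun ω t ↦ B t ω) (fun ω t ↦ inverseProcess D t ω) P) (t p : ℝ≥0) :
    MemLp (timeChange B D t) p P := by
  refine memLp_of_lintegral_abs_rpow_ne_top (aemeasurable_timeChange hD hB t) (fun m hm ↦ ?_) p
  have h := (integral_abs_timeChange_sub_rpow hα hH hD hB hBY (zero_le (a := t)) hm).1
  have h2 := (hasFiniteIntegral_iff_ofReal (ae_of_all _ fun ω ↦ by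
    simp only [Pi.zero_apply]; positivity)).1 h.2
  refine ne_of_lt (lt_of_eq_of_lt (lintegral_congr_ae ?_) h2)
  filter_upwards [timeChange_zero hα hH hD hB] with ω hω
  rw [hω, sub_zero]

theorem integral_timeChange (hα : α ∈ Set.Ioo (0 : ℝ) 1) (hH : 0 < H)
    (hD : IsStableSubordinator α D P) (hB : IsFractionalBrownianMotion H σ B P)
    (hBY : IndepFun (fun ω t ↦ B t ω) (fun ω t ↦ inverseProcess D t ω) P) (t : ℝ≥0) :
    ∫ ω, timeChange B D t ω ∂P = 0 :=
  hB.integral_comp hBY hD.aemeasurable_inverseProcess t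
    (memLp_one_iff_integrable.1 (memLp_timeChange hα hH hD hB hBY t 1))

theorem integral_timeChange_sub_sq (hα : α ∈ Set.Ioo (0 : ℝ) 1) (hH : 0 < H)
    (hD : IsStableSubordinator α D P) (hB : IsFractionalBrownianMotion H σ B P)
    (hBY : IndepFun (fun ω t ↦ B t ω) (fun ω t ↦ inverseProcess D t ω) P)
    {s t : ℝ≥0} (hst : s ≤ t) :
    ∫ ω, (timeChange B D t ω - timeChange B D s ω) ^ 2 ∂P =
      σ ^ 2 * ∫ ω, |(inverseProcess D t ω : ℝ) - inverseProcess D s ω| ^ (2 * H) ∂P := by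
  have h := (integral_abs_timeChange_sub_rpow hα hH hD hB hBY hst two_pos).2
  simp only [Real.rpow_two, sq_abs] at h
  rw [h]
  congr 1
  -- For `m = 2` the Gaussian constant is `2σ² Γ(3/2) / √π = σ²`.
  have hG : Real.Gamma ((2 + 1) / 2) = 1 / 2 * √Real.pi := by
    rw [show ((2 : ℝ) + 1) / 2 = 1 / 2 + 1 by norm_num, Real.Gamma_add_one (by norm_num),
      Real.Gamma_one_half_eq]
  have hpi : 0 < √Real.pi := Real.sqrt_pos.2 Real.pi_pos
  rw [hG, div_self two_ne_zero, Real.rpow_one]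
  field_simp

theorem integral_timeChange_sq (hα : α ∈ Set.Ioo (0 : ℝ) 1) (hH : 0 < H)
    (hD : IsStableSubordinator α D P) (hB : IsFractionalBrownianMotion H σ B P)
    (hBY : IndepFun (fun ω t ↦ B t ω) (fun ω t ↦ inverseProcess D t ω) P) (t : ℝ≥0) :
    ∫ ω, timeChange B D t ω ^ 2 ∂P =
      σ ^ 2 * Real.Gamma (2 * H + 1) * (t : ℝ) ^ (2 * α * H) / Real.Gamma (2 * α * H + 1) := by
  have h := integral_timeChange_sub_sq hα hH hD hB hBY (zero_le (a := t))
  have e1 : ∫ ω, (timeChange B D t ω - timeChange B D 0 ω) ^ 2 ∂P =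
      ∫ ω, timeChange B D t ω ^ 2 ∂P := by
    refine integral_congr_ae ?_
    filter_upwards [timeChange_zero hα hH hD hB] with ω hω
    rw [hω, sub_zero]
  have e2 : ∫ ω, |(inverseProcess D t ω : ℝ) - inverseProcess D 0 ω| ^ (2 * H) ∂P =
      ∫ ω, (inverseProcess D t ω : ℝ) ^ (2 * H) ∂P := by
    refine integral_congr_ae ?_
    filter_upwards [hD.inverseProcess_zero hα] with ω hω
    rw [hω, NNReal.coe_zero, sub_zero, NNReal.abs_eq]
  rw [← e1, h, e2, (hD.integral_inverseProcess_rpow hα t (by positivity)).2,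
    show α * (2 * H) = 2 * α * H by ring]
  ring

theorem variance_timeChange (hα : α ∈ Set.Ioo (0 : ℝ) 1) (hH : 0 < H)
    (hD : IsStableSubordinator α D P) (hB : IsFractionalBrownianMotion H σ B P)
    (hBY : IndepFun (fun ω t ↦ B t ω) (fun ω t ↦ inverseProcess D t ω) P) (t : ℝ≥0) :
    variance (timeChange B D t) P =
      σ ^ 2 * Real.Gamma (2 * H + 1) * (t : ℝ) ^ (2 * α * H) / Real.Gamma (2 * α * H + 1) := by
  rw [variance_of_integral_eq_zero (aemeasurable_timeChange hD hB t)
    (integral_timeChange hα hH hD hB hBY t), integral_timeChange_sq hα hH hD hB hBY t]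

/-- Polarisation: the variance of `Z t` cancels the complete Beta part of the mean square increment,
which leaves the variance of `Z s` and an incomplete Beta term. -/
theorem covariance_timeChange (hα : α ∈ Set.Ioo (0 : ℝ) 1) (hH : 0 < H)
    (hD : IsStableSubordinator α D P) (hB : IsFractionalBrownianMotion H σ B P)
    (hBY : IndepFun (fun ω t ↦ B t ω) (fun ω t ↦ inverseProcess D t ω) P)
    {s t : ℝ≥0} (ht : 0 < t) (hst : s ≤ t) :
    covariance (timeChange B D t) (timeChange B D s) P = σ ^ 2 / 2 *
      (Real.Gamma (2 * H + 1) * (s : ℝ) ^ (2 * α * H) / Real.Gamma (2 * α * H + 1) +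
        Real.Gamma (2 * H + 1) * (t : ℝ) ^ (2 * α * H) /
          (Real.Gamma α * Real.Gamma (α * (2 * H - 1) + 1)) *
          incompleteBeta α (α * (2 * H - 1) + 1) (s / t)) := by
  have hL : ∀ r, MemLp (timeChange B D r) 2 P := fun r ↦ memLp_timeChange hα hH hD hB hBY r 2
  have hsq : ∀ r, Integrable (fun ω ↦ timeChange B D r ω ^ 2) P := fun r ↦ (hL r).integrable_sq
  have hd : Integrable (fun ω ↦ (timeChange B D t ω - timeChange B D s ω) ^ 2) P :=
    ((hL t).sub (hL s)).integrable_sq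
  have hadd : Integrable (fun ω ↦ timeChange B D t ω ^ 2 + timeChange B D s ω ^ 2) P :=
    (hsq t).add (hsq s)
  rw [covariance_eq_sub (hL t) (hL s), integral_timeChange hα hH hD hB hBY, zero_mul, sub_zero]
  have heq : ∀ ω, (timeChange B D t * timeChange B D s) ω = 1 / 2 *
      ((timeChange B D t ω ^ 2 + timeChange B D s ω ^ 2) -
        (timeChange B D t ω - timeChange B D s ω) ^ 2) := fun ω ↦ by
    rw [Pi.mul_apply]; ring
  simp_rw [heq]
  rw [integral_const_mul, integral_sub hadd hd, integral_add (hsq t) (hsq s),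
    integral_timeChange_sq hα hH hD hB hBY, integral_timeChange_sq hα hH hD hB hBY,
    integral_timeChange_sub_sq hα hH hD hB hBY hst,
    (hD.integral_abs_inverseProcess_sub_rpow hα ht hst (show 0 < 2 * H by positivity)).2,
    show α * (2 * H) = 2 * α * H by ring]
  ring

theorem correlation_timeChange_eq (hα : α ∈ Set.Ioo (0 : ℝ) 1) (hH : 0 < H)
    (hD : IsStableSubordinator α D P) (hB : IsFractionalBrownianMotion H σ B P)
    (hBY : IndepFun (fun ω t ↦ B t ω) (fun ω t ↦ inverseProcess D t ω) P) (s t : ℝ≥0) :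
    correlation (timeChange B D t) (timeChange B D s) P =
      covariance (timeChange B D t) (timeChange B D s) P /
        (σ ^ 2 * Real.Gamma (2 * H + 1) / Real.Gamma (2 * α * H + 1) *
          ((t : ℝ) * s) ^ (α * H)) := by
  have hα0 := hα.1
  have h1 : 0 < Real.Gamma (2 * H + 1) := Real.Gamma_pos_of_pos (by positivity)
  have h2 : 0 < Real.Gamma (2 * α * H + 1) := Real.Gamma_pos_of_pos (by positivity)
  have hs : ∀ r : ℝ≥0, √(variance (timeChange B D r) P) =
      √(σ ^ 2 * Real.Gamma (2 * H + 1) / Real.Gamma (2 * α * H + 1)) * (r : ℝ) ^ (α * H) := by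
    intro r
    have hr := r.coe_nonneg
    have e : (r : ℝ) ^ (2 * α * H) = ((r : ℝ) ^ (α * H)) ^ 2 := by
      rw [← Real.rpow_natCast, ← Real.rpow_mul hr]
      congr 1
      push_cast
      ring
    rw [variance_timeChange hα hH hD hB hBY, mul_div_right_comm, e,
      Real.sqrt_mul (by positivity), Real.sqrt_sq (by positivity)]
  rw [correlation, hs, hs, mul_mul_mul_comm, Real.mul_self_sqrt (by positivity),
    Real.mul_rpow t.coe_nonneg s.coe_nonneg]

/-- As `Z 0 = 0` almost surely, this is the difference of two covariances with `Z t`. The summand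
depending on `t` alone cancels, and the two incomplete Beta terms, in unnormalised form, are
integrals over the same interval `[0, t]`. -/
theorem covariance_timeChange_increments (hα : α ∈ Set.Ioo (0 : ℝ) 1) (hH : 0 < H)
    (hD : IsStableSubordinator α D P) (hB : IsFractionalBrownianMotion H σ B P)
    (hBY : IndepFun (fun ω t ↦ B t ω) (fun ω t ↦ inverseProcess D t ω) P)
    {t v : ℝ≥0} (ht : 0 < t) (htv : t ≤ v) :
    covariance (fun ω ↦ timeChange B D t ω - timeChange B D 0 ω)
        (fun ω ↦ timeChange B D (t + v) ω - timeChange B D v ω) P =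
      σ ^ 2 * H * Real.Gamma (2 * H) / (Real.Gamma α * Real.Gamma (α * (2 * H - 1) + 1)) *
        ∫ y in (0 : ℝ)..t,
          (((t : ℝ) + v - y) ^ (α * (2 * H - 1)) - ((v : ℝ) - y) ^ (α * (2 * H - 1))) *
            y ^ (α - 1) := by
  have hα0 := hα.1
  have hb : 0 < α * (2 * H - 1) + 1 := by nlinarith [hα.2]
  have hL : ∀ r, MemLp (timeChange B D r) 2 P := fun r ↦ memLp_timeChange hα hH hD hB hBY r 2
  have hv : 0 < v := ht.trans_le htv
  have htv' : (t : ℝ) ≤ v := htv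
  have hv' : (0 : ℝ) < v := hv
  have ht' : (0 : ℝ) < t := ht
  have e1 : covariance (fun ω ↦ timeChange B D t ω - timeChange B D 0 ω)
        (fun ω ↦ timeChange B D (t + v) ω - timeChange B D v ω) P =
      covariance (timeChange B D (t + v)) (timeChange B D t) P -
        covariance (timeChange B D v) (timeChange B D t) P := by
    rw [covariance_comm (timeChange B D (t + v)), covariance_comm (timeChange B D v)]
    refine Eq.trans ?_ (covariance_sub_right (hL t) (hL (t + v)) (hL v))
    have h0 : (fun ω ↦ timeChange B D t ω - timeChange B D 0 ω) =ᵐ[P] timeChange B D t := by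
      filter_upwards [timeChange_zero hα hH hD hB] with ω hω
      rw [hω, sub_zero]
    rw [covariance, covariance, integral_congr_ae h0]
    refine integral_congr_ae ?_
    filter_upwards [h0] with ω hω
    rw [hω]
    rfl
  have hG : Real.Gamma (2 * H + 1) = 2 * H * Real.Gamma (2 * H) :=
    Real.Gamma_add_one (by positivity)
  have i1 := intervalIntegrable_beta hα0 hb (t := (t : ℝ) + v) (w := 0) (s := t) (by positivity)
    le_rfl (by positivity) ht'.le (by linarith)
  have i2 := intervalIntegrable_beta hα0 hb (t := (v : ℝ)) (w := 0) (s := t) hv'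
    le_rfl hv'.le ht'.le htv'
  have r1 := rpow_mul_incompleteBeta α (α * (2 * H - 1) + 1) (t := (t : ℝ) + v) (s := t)
    (by positivity) ht'.le (by linarith)
  have r2 := rpow_mul_incompleteBeta α (α * (2 * H - 1) + 1) hv' ht'.le htv'
  rw [show α + (α * (2 * H - 1) + 1) - 1 = 2 * α * H by ring] at r1 r2
  rw [e1, covariance_timeChange hα hH hD hB hBY (by positivity) le_self_add,
    covariance_timeChange hα hH hD hB hBY hv htv]
  simp_rw [sub_mul]
  simp only [add_sub_cancel_right] at i1 i2 r1 r2
  rw [intervalIntegral.integral_sub i1 i2, ← r1, ← r2, hG, NNReal.coe_add]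
  ring

end Moments

/-! ### Analytic tools for the limits -/

section Asymptotics

/-- The expansion error is `O((s/t) ^ (a + 1))`, which beats `t ^ p` exactly because `p < a + 1`. -/
theorem tendsto_rpow_mul_incompleteBeta_sub {a b p s : ℝ} (ha : 0 < a) (hb : 0 < b) (hp : p < a + 1)
    (hs : 0 < s) :
    Tendsto (fun t : ℝ ↦ t ^ p * (incompleteBeta a b (s / t) - (s / t) ^ a / a)) atTop (𝓝 0) := by
  have hlim : Tendsto (fun t : ℝ ↦ s / t) atTop (𝓝[>] 0) := by
    refine tendsto_nhdsWithin_iff.2 ⟨tendsto_const_nhds.div_atTop tendsto_id, ?_⟩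
    filter_upwards [eventually_gt_atTop 0] with t ht
    exact div_pos hs ht
  have h1 := (isBigO_refl (fun t : ℝ ↦ t ^ p) atTop).mul
    ((incompleteBeta_sub_isBigO ha hb).comp_tendsto hlim)
  refine h1.trans_tendsto ?_
  have h2 : Tendsto (fun t : ℝ ↦ s ^ (a + 1) * t ^ (-(a + 1 - p))) atTop (𝓝 (s ^ (a + 1) * 0)) :=
    (tendsto_rpow_neg_atTop (by linarith)).const_mul _
  rw [mul_zero] at h2
  refine h2.congr' ?_
  filter_upwards [eventually_gt_atTop 0] with t ht
  simp only [Function.comp_apply]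
  rw [Real.div_rpow hs.le ht.le, neg_sub, Real.rpow_sub ht]
  ring

/-- A vanishing absolute error is also a vanishing relative error once `g` stays away from `0`. -/
theorem isEquivalent_of_tendsto_sub {ι : Type*} {l : Filter ι} {f g : ι → ℝ} {c : ℝ} (hc : 0 < c)
    (h : Tendsto (fun x ↦ f x - g x) l (𝓝 0)) (hg : ∀ᶠ x in l, c ≤ g x) : f ~[l] g := by
  have h1 : (fun x ↦ f x - g x) =o[l] (fun _ ↦ (1 : ℝ)) := (isLittleO_one_iff ℝ).2 h
  refine h1.trans_isBigO (IsBigO.of_bound c⁻¹ ?_)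
  filter_upwards [hg] with x hx
  rw [norm_one, Real.norm_of_nonneg (hc.le.trans hx), ← div_eq_inv_mul, one_le_div hc]
  exact hx

theorem not_summable_of_rpow_isBigO {f : ℕ → ℝ} {p : ℝ} (hp : -1 ≤ p)
    (h : (fun n : ℕ ↦ (n : ℝ) ^ p) =O[atTop] f) : ¬ Summable f := fun hf ↦
  absurd (Real.summable_nat_rpow.1 (summable_of_isBigO_nat hf h)) (not_lt.2 hp)

theorem hasDerivAt_integral_beta {α s t : ℝ} (hα : 0 < α) (hs : 0 < s) (hst : s < t) :
    HasDerivAt (fun s' ↦ ∫ y in (0 : ℝ)..s', (t - y) ^ α * y ^ (α - 1))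
      ((t - s) ^ α * s ^ (α - 1)) s := by
  have hi := intervalIntegrable_beta (b := α + 1) hα (by linarith) (t := t) (w := 0) (s := s)
    (hs.trans hst) le_rfl (hs.trans hst).le hs.le hst.le
  rw [add_sub_cancel_right] at hi
  refine intervalIntegral.integral_hasDerivAt_right hi ?_ ?_
  · exact (show Measurable fun y : ℝ ↦ (t - y) ^ α * y ^ (α - 1) by
      fun_prop).stronglyMeasurable.stronglyMeasurableAtFilter
  · refine ContinuousAt.mul ?_ (Real.continuousAt_rpow_const _ _ (Or.inl hs.ne'))
    exact ContinuousAt.rpow_const (by fun_prop) (Or.inl (by linarith))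

end Asymptotics

/-! ### Second-order structure, long-range dependence and conclusion -/

section Main

variable {Ω : Type*} [MeasurableSpace Ω] {P : Measure Ω} [IsProbabilityMeasure P] {α H σ : ℝ}
  {D B : ℝ≥0 → Ω → ℝ}

theorem IsStableSubordinator.integral_inverseProcess_mul' (hα : α ∈ Set.Ioo (0 : ℝ) 1)
    (hD : IsStableSubordinator α D P) {s t : ℝ≥0} (hs : 0 < s) (hst : s ≤ t) :
    ∫ ω, (inverseProcess D t ω : ℝ) * inverseProcess D s ω ∂P =
      (s : ℝ) ^ (2 * α) / Real.Gamma (2 * α + 1) +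
        1 / (Real.Gamma α * Real.Gamma (α + 1)) *
          ∫ y in (0 : ℝ)..s, ((t : ℝ) - y) ^ α * y ^ (α - 1) := by
  have ht : 0 < t := hs.trans_le hst
  have r := rpow_mul_incompleteBeta α (α + 1) (t := t) (s := s) ht s.coe_nonneg hst
  rw [show α + (α + 1) - 1 = 2 * α by ring, add_sub_cancel_right] at r
  rw [hD.integral_inverseProcess_mul hα ht hst, ← r]
  ring

theorem IsStableSubordinator.covariance_inverseProcess (hα : α ∈ Set.Ioo (0 : ℝ) 1)
    (hD : IsStableSubordinator α D P) {s t : ℝ≥0} (hs : 0 < s) (hst : s ≤ t) :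
    covariance (fun ω ↦ (inverseProcess D t ω : ℝ)) (fun ω ↦ (inverseProcess D s ω : ℝ)) P =
      (s : ℝ) ^ (2 * α) / Real.Gamma (2 * α + 1) +
        (t : ℝ) ^ (2 * α) / (Real.Gamma α * Real.Gamma (α + 1)) *
          incompleteBeta α (α + 1) (s / t) -
        ((t : ℝ) * s) ^ α / Real.Gamma (α + 1) ^ 2 := by
  have hmean : ∀ r : ℝ≥0, ∫ ω, (inverseProcess D r ω : ℝ) ∂P =
      (r : ℝ) ^ α / Real.Gamma (α + 1) := by
    intro r
    have h := (hD.integral_inverseProcess_rpow hα r (γ := 1) zero_le_one).2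
    simpa [one_add_one_eq_two] using h
  rw [covariance_eq_sub (hD.memLp_inverseProcess hα t 2) (hD.memLp_inverseProcess hα s 2),
    hmean, hmean, Real.mul_rpow t.coe_nonneg s.coe_nonneg,
    ← hD.integral_inverseProcess_mul hα (hs.trans_le hst) hst]
  simp only [Pi.mul_apply]
  ring

theorem IsStableSubordinator.hasDerivAt_integral_inverseProcess_mul (hα : α ∈ Set.Ioo (0 : ℝ) 1)
    (hD : IsStableSubordinator α D P) {s t : ℝ} (hs : 0 < s) (hst : s < t) :
    HasDerivAt (fun s' : ℝ ↦
        ∫ ω, (inverseProcess D t.toNNReal ω : ℝ) * inverseProcess D s'.toNNReal ω ∂P)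
      (2 * α * s ^ (2 * α - 1) / Real.Gamma (2 * α + 1) +
        1 / (Real.Gamma α * Real.Gamma (α + 1)) * ((t - s) ^ α * s ^ (α - 1))) s := by
  have h := ((Real.hasDerivAt_rpow_const (p := 2 * α) (Or.inl hs.ne')).div_const
    (Real.Gamma (2 * α + 1))).add ((hasDerivAt_integral_beta hα.1 hs hst).const_mul
      (1 / (Real.Gamma α * Real.Gamma (α + 1))))
  refine h.congr_of_eventuallyEq ?_
  filter_upwards [Ioo_mem_nhds hs hst] with s' hs'
  rw [hD.integral_inverseProcess_mul' hα (Real.toNNReal_pos.2 hs'.1)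
    (Real.toNNReal_le_toNNReal hs'.2.le), Real.coe_toNNReal _ hs'.1.le,
    Real.coe_toNNReal _ (hs.trans hst).le]
  rfl

/-- Of the two terms in the `s`-derivative only `(t - s) ^ α * s ^ (α - 1)` depends on `t`; its
constant simplifies through `Γ(α + 1) = α Γ(α)`. -/
theorem IsStableSubordinator.hasDerivAt_deriv_integral_inverseProcess_mul
    (hα : α ∈ Set.Ioo (0 : ℝ) 1) (hD : IsStableSubordinator α D P) {s t : ℝ} (hs : 0 < s)
    (hst : s < t) :
    HasDerivAt (fun t' : ℝ ↦ deriv (fun s' : ℝ ↦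
        ∫ ω, (inverseProcess D t'.toNNReal ω : ℝ) * inverseProcess D s'.toNNReal ω ∂P) s)
      (1 / (Real.Gamma α ^ 2 * (s * (t - s)) ^ (1 - α))) t := by
  have hα0 := hα.1
  have hts : 0 < t - s := sub_pos.2 hst
  have h1 : HasDerivAt (fun t' : ℝ ↦ (t' - s) ^ α) (1 * α * (t - s) ^ (α - 1)) t :=
    ((hasDerivAt_id t).sub_const s).rpow_const (Or.inl hts.ne')
  have h2 := ((h1.mul_const (s ^ (α - 1))).const_mul
    (1 / (Real.Gamma α * Real.Gamma (α + 1)))).const_add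
      (2 * α * s ^ (2 * α - 1) / Real.Gamma (2 * α + 1))
  have hG : 0 < Real.Gamma α := Real.Gamma_pos_of_pos hα0
  have hval : 1 / (Real.Gamma α ^ 2 * (s * (t - s)) ^ (1 - α)) =
      1 / (Real.Gamma α * Real.Gamma (α + 1)) * (1 * α * (t - s) ^ (α - 1) * s ^ (α - 1)) := by
    rw [Real.Gamma_add_one hα0.ne', Real.mul_rpow hs.le hts.le, ← neg_sub α 1,
      Real.rpow_neg hs.le, Real.rpow_neg hts.le]
    have p1 : 0 < s ^ (α - 1) := by positivity
    have p2 : 0 < (t - s) ^ (α - 1) := by positivity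
    field_simp
  rw [hval]
  refine h2.congr_of_eventuallyEq ?_
  filter_upwards [lt_mem_nhds hst] with t' ht'
  exact (hD.hasDerivAt_integral_inverseProcess_mul hα hs ht').deriv

theorem tendsto_covariance_timeChange_sub (hα : α ∈ Set.Ioo (0 : ℝ) 1) (hH : H ∈ Set.Ioo (0 : ℝ) 1)
    (hD : IsStableSubordinator α D P) (hB : IsFractionalBrownianMotion H σ B P)
    (hBY : IndepFun (fun ω t ↦ B t ω) (fun ω t ↦ inverseProcess D t ω) P) {s : ℝ≥0} (hs : 0 < s) :
    Tendsto (fun t : ℝ≥0 ↦ covariance (timeChange B D t) (timeChange B D s) P - σ ^ 2 / 2 *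
        (Real.Gamma (2 * H + 1) * (s : ℝ) ^ (2 * α * H) / Real.Gamma (2 * α * H + 1) +
          Real.Gamma (2 * H + 1) * (t : ℝ) ^ (2 * α * H) /
            (Real.Gamma (α + 1) * Real.Gamma (α * (2 * H - 1) + 1)) * ((s : ℝ) / t) ^ α))
      atTop (𝓝 0) := by
  obtain ⟨hα0, hα1⟩ := hα
  obtain ⟨hH0, hH1⟩ := hH
  have hb : 0 < α * (2 * H - 1) + 1 := by nlinarith
  have hG : 0 < Real.Gamma α := Real.Gamma_pos_of_pos hα0
  have hGb : 0 < Real.Gamma (α * (2 * H - 1) + 1) := Real.Gamma_pos_of_pos hb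
  -- The growth condition `2αH < α + 1` holds since `H < 1` and `α < 1`.
  have h := (((tendsto_rpow_mul_incompleteBeta_sub (p := 2 * α * H) hα0 hb (by nlinarith)
    (NNReal.coe_pos.2 hs)).const_mul (σ ^ 2 / 2 * (Real.Gamma (2 * H + 1) /
      (Real.Gamma α * Real.Gamma (α * (2 * H - 1) + 1))))).comp
        (NNReal.tendsto_coe_atTop.2 (tendsto_id (x := (atTop : Filter ℝ≥0)))))
  rw [mul_zero] at h
  refine h.congr' ?_
  filter_upwards [eventually_ge_atTop s] with t ht
  simp only [Function.comp_apply, id]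
  rw [covariance_timeChange ⟨hα0, hα1⟩ hH0 hD hB hBY (hs.trans_le ht) ht,
    Real.Gamma_add_one hα0.ne']
  field_simp
  ring

/-- The comparison function never falls below its first summand, a positive constant, so the
absolute error bound upgrades to equivalence. -/
theorem covariance_timeChange_isEquivalent (hα : α ∈ Set.Ioo (0 : ℝ) 1)
    (hH : H ∈ Set.Ioo (0 : ℝ) 1) (hσ : 0 < σ)
    (hD : IsStableSubordinator α D P) (hB : IsFractionalBrownianMotion H σ B P)
    (hBY : IndepFun (fun ω t ↦ B t ω) (fun ω t ↦ inverseProcess D t ω) P) {s : ℝ≥0} (hs : 0 < s) :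
    (fun t : ℝ≥0 ↦ covariance (timeChange B D t) (timeChange B D s) P) ~[atTop]
      (fun t : ℝ≥0 ↦ σ ^ 2 / 2 *
        (Real.Gamma (2 * H + 1) * (s : ℝ) ^ (2 * α * H) / Real.Gamma (2 * α * H + 1) +
          Real.Gamma (2 * H + 1) * (t : ℝ) ^ (2 * α * H) /
            (Real.Gamma (α + 1) * Real.Gamma (α * (2 * H - 1) + 1)) * ((s : ℝ) / t) ^ α)) := by
  have h := tendsto_covariance_timeChange_sub hα hH hD hB hBY hs
  obtain ⟨hα0, hα1⟩ := hα
  obtain ⟨hH0, hH1⟩ := hH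
  have hs' : (0 : ℝ) < s := hs
  have hb : 0 < α * (2 * H - 1) + 1 := by nlinarith
  have h1 : 0 < Real.Gamma (2 * H + 1) := Real.Gamma_pos_of_pos (by positivity)
  have h2 : 0 < Real.Gamma (2 * α * H + 1) := Real.Gamma_pos_of_pos (by positivity)
  have h3 : 0 < Real.Gamma (α + 1) := Real.Gamma_pos_of_pos (by positivity)
  have h4 : 0 < Real.Gamma (α * (2 * H - 1) + 1) := Real.Gamma_pos_of_pos hb
  refine isEquivalent_of_tendsto_sub (c := σ ^ 2 / 2 *
    (Real.Gamma (2 * H + 1) * (s : ℝ) ^ (2 * α * H) / Real.Gamma (2 * α * H + 1)))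
    (by positivity) h (Eventually.of_forall fun t ↦ ?_)
  refine mul_le_mul_of_nonneg_left (le_add_of_nonneg_right ?_) (by positivity)
  positivity

theorem correlation_timeChange (hα : α ∈ Set.Ioo (0 : ℝ) 1) (hH : 0 < H) (hσ : 0 < σ)
    (hD : IsStableSubordinator α D P) (hB : IsFractionalBrownianMotion H σ B P)
    (hBY : IndepFun (fun ω t ↦ B t ω) (fun ω t ↦ inverseProcess D t ω) P)
    {s t : ℝ≥0} (hs : 0 < s) (hst : s ≤ t) :
    correlation (timeChange B D t) (timeChange B D s) P = 1 / 2 *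
        (((s : ℝ) / t) ^ (α * H) +
          Real.Gamma (2 * α * H + 1) / Real.Gamma (2 * H + 1) *
            (Real.Gamma (2 * H + 1) * (t : ℝ) ^ (2 * α * H) /
              (Real.Gamma α * Real.Gamma (α * (2 * H - 1) + 1)) *
              incompleteBeta α (α * (2 * H - 1) + 1) (s / t)) /
            ((t : ℝ) * s) ^ (α * H)) := by
  have hα0 := hα.1
  have ht : 0 < t := hs.trans_le hst
  have hs' : (0 : ℝ) < s := hs
  have ht' : (0 : ℝ) < t := ht
  have h1 : 0 < Real.Gamma (2 * H + 1) := Real.Gamma_pos_of_pos (by positivity)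
  have h2 : 0 < Real.Gamma (2 * α * H + 1) := Real.Gamma_pos_of_pos (by positivity)
  rw [correlation_timeChange_eq hα hH hD hB hBY, covariance_timeChange hα hH hD hB hBY ht hst,
    Real.div_rpow hs'.le ht'.le, Real.mul_rpow ht'.le hs'.le,
    show 2 * α * H = α * H + α * H by ring, Real.rpow_add hs', Real.rpow_add ht']
  have hx : 0 < (s : ℝ) ^ (α * H) := by positivity
  have hy : 0 < (t : ℝ) ^ (α * H) := by positivity
  rw [show 2 * α * H = α * H + α * H by ring] at h2
  field_simp

/-- Division of the covariance equivalence by the product of standard deviations; the Gamma factors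
combine into a Beta function because `α + b = 2αH + 1` for `b = α(2H - 1) + 1`. -/
theorem correlation_timeChange_isEquivalent (hα : α ∈ Set.Ioo (0 : ℝ) 1)
    (hH : H ∈ Set.Ioo (0 : ℝ) 1) (hσ : 0 < σ)
    (hD : IsStableSubordinator α D P) (hB : IsFractionalBrownianMotion H σ B P)
    (hBY : IndepFun (fun ω t ↦ B t ω) (fun ω t ↦ inverseProcess D t ω) P) {s : ℝ≥0} (hs : 0 < s) :
    (fun t : ℝ≥0 ↦ correlation (timeChange B D t) (timeChange B D s) P) ~[atTop]
      (fun t : ℝ≥0 ↦ 1 / 2 * (((s : ℝ) / t) ^ (α * H) +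
        1 / (α * beta α (α * (2 * H - 1) + 1)) * ((s : ℝ) / t) ^ (α * (1 - H)))) := by
  have h := covariance_timeChange_isEquivalent hα hH hσ hD hB hBY hs
  obtain ⟨hα0, hα1⟩ := hα
  obtain ⟨hH0, hH1⟩ := hH
  have hs' : (0 : ℝ) < s := hs
  have hb : 0 < α * (2 * H - 1) + 1 := by nlinarith
  have h1 : 0 < Real.Gamma (2 * H + 1) := Real.Gamma_pos_of_pos (by positivity)
  have h2 : 0 < Real.Gamma (2 * α * H + 1) := Real.Gamma_pos_of_pos (by positivity)
  have h3 : 0 < Real.Gamma α := Real.Gamma_pos_of_pos hα0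
  have h4 : 0 < Real.Gamma (α * (2 * H - 1) + 1) := Real.Gamma_pos_of_pos hb
  have hq := h.div (IsEquivalent.refl (u := fun t : ℝ≥0 ↦
    σ ^ 2 * Real.Gamma (2 * H + 1) / Real.Gamma (2 * α * H + 1) * ((t : ℝ) * s) ^ (α * H)))
  refine (hq.congr_left (Eventually.of_forall fun t ↦ ?_)).congr_right ?_
  · exact (correlation_timeChange_eq ⟨hα0, hα1⟩ hH0 hD hB hBY s t).symm
  · filter_upwards [eventually_gt_atTop 0] with t ht
    have ht' : (0 : ℝ) < t := ht
    simp only [Pi.div_apply]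
    rw [beta, show α + (α * (2 * H - 1) + 1) = 2 * α * H + 1 by ring, Real.Gamma_add_one hα0.ne',
      show α * (1 - H) = α - α * H by ring, Real.rpow_sub (div_pos hs' ht'),
      Real.div_rpow hs'.le ht'.le (α * H), Real.mul_rpow ht'.le hs'.le,
      show 2 * α * H = α * H + α * H by ring, Real.rpow_add hs', Real.rpow_add ht']
    have hx : 0 < (s : ℝ) ^ (α * H) := by positivity
    have hy : 0 < (t : ℝ) ^ (α * H) := by positivity
    rw [show 2 * α * H = α * H + α * H by ring] at h2
    field_simp

/-- The incomplete Beta term is nonnegative, so the correlation is at least `(s/n) ^ (αH) / 2` once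
`n ≥ s`, and `αH < 1`. -/
theorem not_summable_correlation_timeChange (hα : α ∈ Set.Ioo (0 : ℝ) 1)
    (hH : H ∈ Set.Ioo (0 : ℝ) 1) (hσ : 0 < σ)
    (hD : IsStableSubordinator α D P) (hB : IsFractionalBrownianMotion H σ B P)
    (hBY : IndepFun (fun ω t ↦ B t ω) (fun ω t ↦ inverseProcess D t ω) P) {s : ℝ≥0} (hs : 0 < s) :
    ¬ Summable fun n : ℕ ↦ correlation (timeChange B D n) (timeChange B D s) P := by
  have hs' : (0 : ℝ) < s := hs
  have hα0 := hα.1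
  have hH0 := hH.1
  have hb : 0 < α * (2 * H - 1) + 1 := by nlinarith [hα.2]
  have h1 : 0 < Real.Gamma (2 * H + 1) := Real.Gamma_pos_of_pos (by positivity)
  have h2 : 0 < Real.Gamma (2 * α * H + 1) := Real.Gamma_pos_of_pos (by positivity)
  have h3 : 0 < Real.Gamma α := Real.Gamma_pos_of_pos hα0
  have h4 : 0 < Real.Gamma (α * (2 * H - 1) + 1) := Real.Gamma_pos_of_pos hb
  refine not_summable_of_rpow_isBigO (p := -(α * H)) (by nlinarith [hα.2, hH.2])
    (IsBigO.of_bound (2 / (s : ℝ) ^ (α * H)) ?_)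
  obtain ⟨N, hN⟩ := exists_nat_ge s
  filter_upwards [eventually_ge_atTop N] with n hn
  have hsn : s ≤ (n : ℝ≥0) := hN.trans (Nat.cast_le.2 hn)
  have hn0 : (0 : ℝ) < ((n : ℝ≥0) : ℝ) := hs.trans_le hsn
  have hB0 := incompleteBeta_nonneg α (α * (2 * H - 1) + 1) (z := (s : ℝ) / (n : ℝ≥0))
    ⟨by positivity, (div_le_one hn0).2 hsn⟩
  have hx : 0 < (s : ℝ) ^ (α * H) := by positivity
  have hle : 1 / 2 * ((s : ℝ) / (n : ℝ≥0)) ^ (α * H) ≤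
      correlation (timeChange B D n) (timeChange B D s) P := by
    rw [correlation_timeChange hα hH0 hσ hD hB hBY hs hsn]
    refine mul_le_mul_of_nonneg_left (le_add_of_nonneg_right ?_) (by positivity)
    positivity
  have hpos : 0 ≤ 1 / 2 * ((s : ℝ) / (n : ℝ≥0)) ^ (α * H) := by positivity
  rw [Real.norm_of_nonneg (by positivity), Real.norm_of_nonneg (hpos.trans hle)]
  refine le_trans (le_of_eq ?_) (mul_le_mul_of_nonneg_left hle (by positivity))
  rw [Real.div_rpow hs'.le hn0.le, Real.rpow_neg n.cast_nonneg, NNReal.coe_natCast]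
  field_simp

/-- For `H = 1/2` the second Beta parameter is `1` and the incomplete Beta function is the power `z
^ α / α`; the dependence of the covariance on `t` cancels. -/
theorem covariance_timeChange_half (hα : α ∈ Set.Ioo (0 : ℝ) 1) (hσ : 0 < σ)
    (hD : IsStableSubordinator α D P) (hB : IsFractionalBrownianMotion (1 / 2) σ B P)
    (hBY : IndepFun (fun ω t ↦ B t ω) (fun ω t ↦ inverseProcess D t ω) P)
    {s t : ℝ≥0} (hs : 0 < s) (hst : s ≤ t) :
    covariance (timeChange B D t) (timeChange B D s) P =
        σ ^ 2 / Real.Gamma (α + 1) * (s : ℝ) ^ α ∧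
      correlation (timeChange B D t) (timeChange B D s) P = ((s : ℝ) / t) ^ (α / 2) := by
  have hα0 := hα.1
  have hs' : (0 : ℝ) < s := hs
  have ht' : (0 : ℝ) < t := hs'.trans_le hst
  have h1 : 0 < Real.Gamma (α + 1) := Real.Gamma_pos_of_pos (by positivity)
  have h3 : 0 < Real.Gamma α := Real.Gamma_pos_of_pos hα0
  have hI : ∀ z : ℝ, incompleteBeta α 1 z = z ^ α / α := by
    intro z
    simp only [incompleteBeta, sub_self, Real.rpow_zero, mul_one]
    rw [integral_rpow (Or.inl (by linarith)), sub_add_cancel, Real.zero_rpow hα0.ne', sub_zero]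
  have hcov : covariance (timeChange B D t) (timeChange B D s) P =
      σ ^ 2 / Real.Gamma (α + 1) * (s : ℝ) ^ α := by
    rw [covariance_timeChange hα one_half_pos hD hB hBY (hs.trans_le hst) hst,
      show α * (2 * (1 / 2) - 1) + 1 = 1 by ring, hI, show 2 * α * (1 / 2) = α by ring,
      show (2 : ℝ) * (1 / 2) + 1 = 2 by norm_num, Real.Gamma_two, Real.Gamma_one,
      Real.Gamma_add_one hα0.ne', Real.div_rpow hs'.le ht'.le]
    have : 0 < (t : ℝ) ^ α := by positivity
    field_simp
    ring
  refine ⟨hcov, ?_⟩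
  rw [correlation_timeChange_eq hα one_half_pos hD hB hBY, hcov,
    show (2 : ℝ) * (1 / 2) + 1 = 2 by norm_num, Real.Gamma_two,
    show 2 * α * (1 / 2) = α by ring, show α * (1 / 2) = α / 2 by ring,
    Real.div_rpow hs'.le ht'.le, Real.mul_rpow ht'.le hs'.le]
  have e : (s : ℝ) ^ α = (s : ℝ) ^ (α / 2) * (s : ℝ) ^ (α / 2) := by
    rw [← Real.rpow_add hs', add_halves]
  have hx : 0 < (s : ℝ) ^ (α / 2) := by positivity
  have hy : 0 < (t : ℝ) ^ (α / 2) := by positivity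
  rw [e]
  field_simp

theorem covariance_timeChange_increments_isEquivalent (hα : α ∈ Set.Ioo (0 : ℝ) 1)
    (hH : H ∈ Set.Ioo (0 : ℝ) 1) (hH2 : H ≠ 1 / 2) (hσ : 0 < σ)
    (hD : IsStableSubordinator α D P) (hB : IsFractionalBrownianMotion H σ B P)
    (hBY : IndepFun (fun ω t ↦ B t ω) (fun ω t ↦ inverseProcess D t ω) P) {t : ℝ≥0} (ht : 0 < t) :
    (fun v : ℝ≥0 ↦ covariance (fun ω ↦ timeChange B D t ω - timeChange B D 0 ω)
        (fun ω ↦ timeChange B D (t + v) ω - timeChange B D v ω) P) ~[atTop]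
      (fun v : ℝ≥0 ↦ σ ^ 2 / 2 * Real.Gamma (2 * H + 1) * (t : ℝ) ^ (α + 1) /
        (Real.Gamma (α + 1) * Real.Gamma (α * (2 * H - 1))) *
          (v : ℝ) ^ (α * (2 * H - 1) - 1)) := by
  have hα0 := hα.1
  have hH0 := hH.1
  have hδ : α * (2 * H - 1) ≠ 0 :=
    mul_ne_zero hα0.ne' fun hc ↦ hH2 (by linarith)
  have hb : 0 < α * (2 * H - 1) + 1 := by nlinarith [hα.2]
  have h3 : 0 < Real.Gamma α := Real.Gamma_pos_of_pos hα0
  have h4 : 0 < Real.Gamma (α * (2 * H - 1) + 1) := Real.Gamma_pos_of_pos hb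
  -- For `H < 1/2` the argument is negative, so positivity is unavailable; the recurrence `Γ(δ + 1)
  -- = δ Γ(δ)` with `Γ(δ + 1) > 0` still excludes a zero.
  have h5 : Real.Gamma (α * (2 * H - 1)) ≠ 0 := by
    intro hc
    rw [Real.Gamma_add_one hδ, hc, mul_zero] at h4
    exact lt_irrefl _ h4
  have h := ((integral_rpow_increment_isEquivalent hα0 hδ
    (show α * (2 * H - 1) < 1 by nlinarith [hα.2, hH.2]) (NNReal.coe_pos.2 ht)).comp_tendsto
      (NNReal.tendsto_coe_atTop.2 (tendsto_id (x := (atTop : Filter ℝ≥0)))))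
  have hq := (IsEquivalent.refl (l := (atTop : Filter ℝ≥0)) (u := fun _ : ℝ≥0 ↦
    σ ^ 2 * H * Real.Gamma (2 * H) /
      (Real.Gamma α * Real.Gamma (α * (2 * H - 1) + 1)))).mul h
  refine (hq.congr_left ?_).congr_right (Eventually.of_forall fun v ↦ ?_)
  · filter_upwards [eventually_ge_atTop t] with v hv
    rw [covariance_timeChange_increments hα hH0 hD hB hBY ht hv]
    rfl
  · simp only [Pi.mul_apply, Function.comp_apply, id]
    rw [Real.Gamma_add_one hδ, Real.Gamma_add_one hα0.ne',
      Real.Gamma_add_one (show 2 * H ≠ 0 by positivity)]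
    generalize α * (2 * H - 1) = δ at *
    field_simp

/-- The decay exponent `α(2H - 1) - 1` exceeds `-1` when `H > 1/2`, and the leading coefficient is
then positive. -/
theorem not_summable_covariance_timeChange_increments (hα : α ∈ Set.Ioo (0 : ℝ) 1)
    (hH : H ∈ Set.Ioo (0 : ℝ) 1) (hH2 : 1 / 2 < H) (hσ : 0 < σ)
    (hD : IsStableSubordinator α D P) (hB : IsFractionalBrownianMotion H σ B P)
    (hBY : IndepFun (fun ω t ↦ B t ω) (fun ω t ↦ inverseProcess D t ω) P) {t : ℝ≥0} (ht : 0 < t) :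
    ¬ Summable fun n : ℕ ↦ covariance (fun ω ↦ timeChange B D t ω - timeChange B D 0 ω)
        (fun ω ↦ timeChange B D (t + n) ω - timeChange B D n ω) P := by
  have hα0 := hα.1
  have hH0 := hH.1
  have ht' : (0 : ℝ) < t := ht
  have hδ : 0 < α * (2 * H - 1) := mul_pos hα0 (by linarith)
  have h1 : 0 < Real.Gamma (2 * H + 1) := Real.Gamma_pos_of_pos (by positivity)
  have h3 : 0 < Real.Gamma (α + 1) := Real.Gamma_pos_of_pos (by positivity)
  have h4 : 0 < Real.Gamma (α * (2 * H - 1)) := Real.Gamma_pos_of_pos hδ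
  have h := (covariance_timeChange_increments_isEquivalent hα hH hH2.ne' hσ hD hB hBY ht).symm.isBigO
  have hn := h.comp_tendsto (tendsto_natCast_atTop_atTop (R := ℝ≥0))
  refine not_summable_of_rpow_isBigO (p := α * (2 * H - 1) - 1) (by linarith) ?_
  refine IsBigO.trans ?_ hn
  refine (IsBigO.of_bound (σ ^ 2 / 2 * Real.Gamma (2 * H + 1) * (t : ℝ) ^ (α + 1) /
        (Real.Gamma (α + 1) * Real.Gamma (α * (2 * H - 1))))⁻¹ (Eventually.of_forall fun n ↦ ?_))
  simp only [Function.comp_apply, NNReal.coe_natCast]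
  rw [norm_mul, Real.norm_of_nonneg (show 0 ≤ σ ^ 2 / 2 * Real.Gamma (2 * H + 1) * (t : ℝ) ^ (α + 1) /
        (Real.Gamma (α + 1) * Real.Gamma (α * (2 * H - 1))) by positivity), ← mul_assoc,
    inv_mul_cancel₀ (by positivity), one_mul]

end Main

theorem mainTheorem3 {Ω : Type*} [MeasurableSpace Ω] (P : Measure Ω) [IsProbabilityMeasure P]
    (α H σ : ℝ) (hα : α ∈ Set.Ioo (0 : ℝ) 1) (hH : H ∈ Set.Ioo (0 : ℝ) 1) (hσ : 0 < σ)
    (D B : ℝ≥0 → Ω → ℝ) (Y : ℝ≥0 → Ω → ℝ≥0) (Z : ℝ≥0 → Ω → ℝ)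
    (hD : IsStableSubordinator α D P)
    (hB : IsFractionalBrownianMotion H σ B P)
    (hY : Y = inverseProcess D)
    (hBY : IndepFun (fun ω t ↦ B t ω) (fun ω t ↦ Y t ω) P)
    (hZ : Z = fun t ω ↦ B (Y t ω) ω) :
    -- all moments of `Y t` and `Z t` are finite
    (∀ t p : ℝ≥0, MemLp (fun ω ↦ (Y t ω : ℝ)) p P ∧ MemLp (Z t) p P) ∧
    -- Mittag-Leffler distribution of `Y t`
    (∀ (t : ℝ≥0) (x : ℝ), 0 ≤ x →
      HasSum (fun k : ℕ ↦ (-(x * (t : ℝ) ^ α)) ^ k / Real.Gamma (α * k + 1))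
        (∫ ω, Real.exp (-(x * Y t ω)) ∂P)) ∧
    -- moment of order `2H` of `Y t`
    (∀ t : ℝ≥0, momentFunction Y P (2 * H) t =
      Real.Gamma (2 * H + 1) * (t : ℝ) ^ (2 * α * H) / Real.Gamma (2 * α * H + 1)) ∧
    -- mean and variance of `Z t`
    (∀ t : ℝ≥0, ∫ ω, Z t ω ∂P = 0 ∧ variance (Z t) P =
      σ ^ 2 * Real.Gamma (2 * H + 1) * (t : ℝ) ^ (2 * α * H) / Real.Gamma (2 * α * H + 1)) ∧
    -- covariance and correlation functions of `Z`
    (∀ s t : ℝ≥0, 0 < s → s ≤ t →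
      covariance (Z t) (Z s) P = σ ^ 2 / 2 *
        (Real.Gamma (2 * H + 1) * (s : ℝ) ^ (2 * α * H) / Real.Gamma (2 * α * H + 1) +
          Real.Gamma (2 * H + 1) * (t : ℝ) ^ (2 * α * H) /
            (Real.Gamma α * Real.Gamma (α * (2 * H - 1) + 1)) *
            incompleteBeta α (α * (2 * H - 1) + 1) (s / t)) ∧
      correlation (Z t) (Z s) P = 1 / 2 *
        (((s : ℝ) / t) ^ (α * H) +
          Real.Gamma (2 * α * H + 1) / Real.Gamma (2 * H + 1) *
            (Real.Gamma (2 * H + 1) * (t : ℝ) ^ (2 * α * H) /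
              (Real.Gamma α * Real.Gamma (α * (2 * H - 1) + 1)) *
              incompleteBeta α (α * (2 * H - 1) + 1) (s / t)) /
            ((t : ℝ) * s) ^ (α * H))) ∧
    -- the case of Brownian motion
    (H = 1 / 2 → ∀ s t : ℝ≥0, 0 < s → s ≤ t →
      covariance (Z t) (Z s) P = σ ^ 2 / Real.Gamma (α + 1) * (s : ℝ) ^ α ∧
      correlation (Z t) (Z s) P = ((s : ℝ) / t) ^ (α / 2)) ∧
    -- asymptotics of the covariance and of the correlation as `t → ∞`, for fixed `s`
    (∀ s : ℝ≥0, 0 < s →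
      Tendsto (fun t : ℝ≥0 ↦ covariance (Z t) (Z s) P - σ ^ 2 / 2 *
        (Real.Gamma (2 * H + 1) * (s : ℝ) ^ (2 * α * H) / Real.Gamma (2 * α * H + 1) +
          Real.Gamma (2 * H + 1) * (t : ℝ) ^ (2 * α * H) /
            (Real.Gamma (α + 1) * Real.Gamma (α * (2 * H - 1) + 1)) * ((s : ℝ) / t) ^ α))
        atTop (𝓝 0) ∧
      (fun t : ℝ≥0 ↦ covariance (Z t) (Z s) P) ~[atTop] (fun t : ℝ≥0 ↦ σ ^ 2 / 2 *
        (Real.Gamma (2 * H + 1) * (s : ℝ) ^ (2 * α * H) / Real.Gamma (2 * α * H + 1) +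
          Real.Gamma (2 * H + 1) * (t : ℝ) ^ (2 * α * H) /
            (Real.Gamma (α + 1) * Real.Gamma (α * (2 * H - 1) + 1)) * ((s : ℝ) / t) ^ α)) ∧
      (fun t : ℝ≥0 ↦ correlation (Z t) (Z s) P) ~[atTop] (fun t : ℝ≥0 ↦ 1 / 2 *
        (((s : ℝ) / t) ^ (α * H) +
          1 / (α * beta α (α * (2 * H - 1) + 1)) * ((s : ℝ) / t) ^ (α * (1 - H)))) ∧
      ¬ Summable (fun n : ℕ ↦ correlation (Z n) (Z s) P)) ∧
    -- absolute moments of the increments of `Y` and of `Z`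
    (∀ s t : ℝ≥0, 0 < s → s ≤ t →
      (∀ κ : ℝ, 0 < κ → ∫ ω, |(Y t ω : ℝ) - Y s ω| ^ κ ∂P =
        Real.Gamma (κ + 1) * (t : ℝ) ^ (α * κ) / Real.Gamma (α * κ + 1) -
          Real.Gamma (κ + 1) * (t : ℝ) ^ (α * κ) /
            (Real.Gamma α * Real.Gamma (α * (κ - 1) + 1)) *
            incompleteBeta α (α * (κ - 1) + 1) (s / t)) ∧
      (∀ m : ℝ, 0 < m → ∫ ω, |Z t ω - Z s ω| ^ m ∂P =
        (2 * σ ^ 2) ^ (m / 2) * Real.Gamma ((m + 1) / 2) * Real.Gamma (m * H + 1) *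
            (t : ℝ) ^ (α * m * H) / √Real.pi *
          (1 / Real.Gamma (α * m * H + 1) -
            incompleteBeta α (α * (m * H - 1) + 1) (s / t) /
              (Real.Gamma α * Real.Gamma (α * (m * H - 1) + 1))))) ∧
    -- second-order structure of `Y`
    (∀ s t : ℝ≥0, 0 < s → s ≤ t →
      ∫ ω, (Y t ω : ℝ) * Y s ω ∂P =
        (s : ℝ) ^ (2 * α) / Real.Gamma (2 * α + 1) +
          1 / (Real.Gamma α * Real.Gamma (α + 1)) *
            ∫ y in (0 : ℝ)..s, ((t : ℝ) - y) ^ α * y ^ (α - 1) ∧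
      covariance (fun ω ↦ (Y t ω : ℝ)) (fun ω ↦ (Y s ω : ℝ)) P =
        (s : ℝ) ^ (2 * α) / Real.Gamma (2 * α + 1) +
          (t : ℝ) ^ (2 * α) / (Real.Gamma α * Real.Gamma (α + 1)) *
            incompleteBeta α (α + 1) (s / t) -
          ((t : ℝ) * s) ^ α / Real.Gamma (α + 1) ^ 2) ∧
    (∀ s t : ℝ, 0 < s → s < t →
      (∀ᶠ t' in 𝓝 t, DifferentiableAt ℝ
        (fun s' : ℝ ↦ ∫ ω, (Y t'.toNNReal ω : ℝ) * Y s'.toNNReal ω ∂P) s) ∧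
      HasDerivAt
        (fun t' : ℝ ↦ deriv (fun s' : ℝ ↦ ∫ ω, (Y t'.toNNReal ω : ℝ) * Y s'.toNNReal ω ∂P) s)
        (1 / (Real.Gamma α ^ 2 * (s * (t - s)) ^ (1 - α))) t) ∧
    -- covariance of far-apart increments of `Z`
    (∀ t v : ℝ≥0, 0 < t → t ≤ v →
      covariance (fun ω ↦ Z t ω - Z 0 ω) (fun ω ↦ Z (t + v) ω - Z v ω) P =
        σ ^ 2 * H * Real.Gamma (2 * H) / (Real.Gamma α * Real.Gamma (α * (2 * H - 1) + 1)) *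
          ∫ y in (0 : ℝ)..t,
            (((t : ℝ) + v - y) ^ (α * (2 * H - 1)) - ((v : ℝ) - y) ^ (α * (2 * H - 1))) *
              y ^ (α - 1)) ∧
    -- its power-law decay as `v → ∞`; for `H = 1/2` it vanishes
    (∀ t : ℝ≥0, 0 < t →
      (H ≠ 1 / 2 →
        (fun v : ℝ≥0 ↦ covariance (fun ω ↦ Z t ω - Z 0 ω) (fun ω ↦ Z (t + v) ω - Z v ω) P)
          ~[atTop] (fun v : ℝ≥0 ↦
            σ ^ 2 / 2 * Real.Gamma (2 * H + 1) * (t : ℝ) ^ (α + 1) /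
              (Real.Gamma (α + 1) * Real.Gamma (α * (2 * H - 1))) *
              (v : ℝ) ^ (α * (2 * H - 1) - 1))) ∧
      (H = 1 / 2 → ∀ v : ℝ≥0, t ≤ v →
        covariance (fun ω ↦ Z t ω - Z 0 ω) (fun ω ↦ Z (t + v) ω - Z v ω) P = 0) ∧
      (1 / 2 < H → ¬ Summable (fun n : ℕ ↦
        covariance (fun ω ↦ Z t ω - Z 0 ω) (fun ω ↦ Z (t + n) ω - Z n ω) P))) := by
  subst hY
  obtain rfl : Z = timeChange B D := hZ
  have hα0 := hα.1
  have hH0 := hH.1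
  refine ⟨fun t p ↦ ⟨hD.memLp_inverseProcess hα t p, memLp_timeChange hα hH0 hD hB hBY t p⟩,
    fun t x hx ↦ hD.hasSum_mittagLeffler hα t hx, fun t ↦ ?_,
    fun t ↦ ⟨integral_timeChange hα hH0 hD hB hBY t, variance_timeChange hα hH0 hD hB hBY t⟩,
    fun s t hs hst ↦ ⟨covariance_timeChange hα hH0 hD hB hBY (hs.trans_le hst) hst,
      correlation_timeChange hα hH0 hσ hD hB hBY hs hst⟩,
    ?_,
    fun s hs ↦ ⟨tendsto_covariance_timeChange_sub hα hH hD hB hBY hs,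
      covariance_timeChange_isEquivalent hα hH hσ hD hB hBY hs,
      correlation_timeChange_isEquivalent hα hH hσ hD hB hBY hs,
      not_summable_correlation_timeChange hα hH hσ hD hB hBY hs⟩,
    fun s t hs hst ↦ ⟨fun κ hκ ↦
      (hD.integral_abs_inverseProcess_sub_rpow hα (hs.trans_le hst) hst hκ).2, fun m hm ↦ ?_⟩,
    fun s t hs hst ↦ ⟨hD.integral_inverseProcess_mul' hα hs hst,
      hD.covariance_inverseProcess hα hs hst⟩,
    fun s t hs hst ↦ ⟨?_, hD.hasDerivAt_deriv_integral_inverseProcess_mul hα hs hst⟩,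
    fun t v ht htv ↦ covariance_timeChange_increments hα hH0 hD hB hBY ht htv,
    fun t ht ↦ ⟨fun hH2 ↦
      covariance_timeChange_increments_isEquivalent hα hH hH2 hσ hD hB hBY ht, ?_,
      fun hH2 ↦ not_summable_covariance_timeChange_increments hα hH hH2 hσ hD hB hBY ht⟩⟩
  · rw [momentFunction, (hD.integral_inverseProcess_rpow hα t (by positivity)).2,
      show α * (2 * H) = 2 * α * H by ring]
  · rintro rfl s t hs hst
    exact covariance_timeChange_half hα hσ hD hB hBY hs hst
  · have hmH : 0 < m * H := by positivity
    rw [(integral_abs_timeChange_sub_rpow hα hH0 hD hB hBY hst hm).2,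
      (hD.integral_abs_inverseProcess_sub_rpow hα (hs.trans_le hst) hst hmH).2,
      show α * (m * H) = α * m * H by ring]
    ring
  · filter_upwards [lt_mem_nhds hst] with t' ht'
    exact (hD.hasDerivAt_integral_inverseProcess_mul hα hs ht').differentiableAt
  · rintro rfl v htv
    rw [covariance_timeChange_increments hα hH0 hD hB hBY ht htv]
    -- For `H = 1/2` both exponents `α(2H - 1)` are `0`, so the bracket in the integrand is `1 - 1`.
    simp
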